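/- **Setting.** Let $\mathcal X$ be a measurable space and $\mathcal H$ a reproducing kernel Hilbert space of real functions on $\mathcal X$ with a measurable kernel $k$ such that $0\le k(x,y)\le\mathbb G$ for all $x,y$. For probability measures $p,q$ on $\mathcal X$ let $$d(p,q)=\sup_{f\in\mathcal H,\ \|f\|\le 1}\big(\mathbb E_p[f(X)]-\mathbb E_q[f(Y)]\big)$$ be the maximum mean discrepancy (MMD). Let $K\ge 2$ and let $D_k=\{p_k^j: j=1,\dots,M_k\}$ ($k=1,\dots,K$, $M_k\ge1$) be nonempty finite clusters of probability measures on $\mathcal X$. Put $$d_H=\min_{k\ne l}\ \min_{p\in D_k,\,q\in D_l} d(p,q),\qquad d_I=\max_k\ \max_{D_{1}\sqcup D_{2}=D_k}\ \min_{p\in D_{1},\,q\in D_{2}} d(p,q),$$ where $D_1,D_2$ are nonempty (and $d_I=0$ if every cluster consists of one distribution). Assume $d_I<d_H$. A configuration assigns to each of $M$ data sequences $X^{(1)},\dots,X^{(M)}$ one of the distributions $p_k^j$ in such a way that every $p_k^j$ is assigned at least once. All samples $X^{(i)}_l$ are independent, and $X^{(i)}_l$, $l\ge1$, have the distribution assigned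 to $i$. The true clusters are $P_k=\{i: X^{(i)}\text{ has a distribution from }D_k\}$. **Algorithm.** After $n$ samples of each sequence the distances are estimated by $$\hat d(i,j,n)=\Big(\tfrac1{n^2}\sum_{l,m=1}^n\big(k(X^{(i)}_l,X^{(i)}_m)+k(X^{(j)}_l,X^{(j)}_m)-2k(X^{(i)}_l,X^{(j)}_m)\big)\Big)^{1/2}.$$ Single linkage clustering (SLINK) applied to $\hat d(\cdot,\cdot,n)$ starts from $M$ singletons and repeatedly merges two closest clusters (the distance of two clusters being the minimum of $\hat d(i,j,n)$ over $i$ in one and $j$ in the other, and ties being broken by an arbitrary fixed rule) until $K$ clusters $C_1(n),\dots,C_K(n)$ are left. Let $\Gamma_n=\min_{k\ne l}\min_{i\in C_k(n),\,j\in C_l(n)}\hat d(i,j,n)$. For $C>0$, the algorithm SLINK-SEQ stops at $N=\min\{n\ge 2:\Gamma_n\ge C/\sqrt n\}$ and outputs $\{C_1(N),\dots,C_K(N)\}$. The error probability of a configuration is the probability that this output is not $\{P_1,\dots,P_K\}$ (not stopping counts as an error), and $P_{\max}=P_{\max}(C)$ is the maximum of the error probabilities over all configurations. **Theorem.** SLINK-SEQ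 is exponentially consistent: for some $\alpha>0$ and every configuration, $$\mathbb E[N]\le\frac{-\log P_{\max}}{\alpha}\,(1+o(1))\qquad (C\to\infty),$$ where $-\log 0=+\infty$. More precisely, for every $\delta$ with $0<\delta<1-\sqrt{d_I/d_H}$ and every $d_{th}$ with $d_I<d_{th}<d_H$ one may take $$\alpha=\alpha_1 d_H^2,\qquad \alpha_1=\min\Big\{\frac{\delta^2}{16\mathbb G},\ \frac{b_f}{(1-\delta)^2d_H^2}\Big\}>0,\qquad b_f=\min\Big\{\frac{(d_{th}-d_I)^2}{16\mathbb G},\ \frac{(d_H-d_{th})^2}{16\mathbb G}\Big\}.$$ -/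

import Mathlib

open MeasureTheory Filter Topology
open scoped ENNReal

namespace SlinkSeq

/-! ### Maximum mean discrepancy -/

section Distances

variable {𝓧 : Type*} [MeasurableSpace 𝓧]
variable (H : Type*) [NormedAddCommGroup H] [InnerProductSpace ℝ H] [RKHS ℝ H 𝓧 ℝ]

/-- The real-valued reproducing kernel `k(x, y)` of the reproducing kernel Hilbert space `H`. -/
noncomputable def kern [CompleteSpace H] (x y : 𝓧) : ℝ := RKHS.kernel H x y 1

/-- The maximum mean discrepancy of `p` and `q`: the supremum of `E_p f(X) - E_q f(Y)` over the
unit ball of the reproducing kernel Hilbert space `H`. -/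
noncomputable def mmd (p q : Measure 𝓧) : ℝ :=
  ⨆ f : Metric.closedBall (0 : H) 1, ((∫ x, (f : H) x ∂p) - ∫ y, (f : H) y ∂q)

end Distances

/-- The (biased) estimate of the maximum mean discrepancy from the first `n` samples of the two
sequences `x` and `y`. -/
noncomputable def mmdEst {𝓧 : Type*} (k : 𝓧 → 𝓧 → ℝ) (x y : ℕ → 𝓧) (n : ℕ) : ℝ :=
  √((1 / (n : ℝ) ^ 2) * ∑ l ∈ Finset.range n, ∑ m ∈ Finset.range n,
      (k (x l) (x m) + k (y l) (y m) - 2 * k (x l) (y m)))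

/-! ### Clusterings of a finite set and their distances -/

section Clusters

variable {ι : Type*}

/-- The distance of two sets of points: `min_{i ∈ A, j ∈ B} d(i, j)`. -/
noncomputable def linkage (d : ι → ι → ℝ) (A B : Finset ι) : ℝ :=
  sInf {r | ∃ i ∈ A, ∃ j ∈ B, r = d i j}

/-- The clusters `{i : c i = k}`, `k = 1, …, K`, given by a labelling `c`. -/
def clustersOf [Fintype ι] [DecidableEq ι] {K : ℕ} (c : ι → Fin K) : Finset (Finset ι) :=
  Finset.univ.image fun k => Finset.univ.filter fun i => c i = k

/-- The minimum inter-cluster distance of a clustering. -/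
noncomputable def minInter (d : ι → ι → ℝ) (𝒞 : Finset (Finset ι)) : ℝ :=
  sInf {r | ∃ A ∈ 𝒞, ∃ B ∈ 𝒞, A ≠ B ∧ r = linkage d A B}

/-- The maximum, over all clusters and all partitions of a cluster into two (nonempty) sub-clusters,
of the distance of the two sub-clusters. If no cluster can be partitioned, its value is `0`. -/
noncomputable def maxSub [DecidableEq ι] (d : ι → ι → ℝ) (𝒞 : Finset (Finset ι)) : ℝ :=
  sSup {r | ∃ D ∈ 𝒞, ∃ A B : Finset ι, A.Nonempty ∧ B.Nonempty ∧ A ∪ B = D ∧ A ∩ B = ∅ ∧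
    r = linkage d A B}

end Clusters

/-! ### The distribution clusters

The `k`-th distribution cluster consists of `p ⟨k, j⟩`, `j = 1, …, m k`. -/

section Distributions

variable {𝓧 : Type*} [MeasurableSpace 𝓧]
variable (H : Type*) [NormedAddCommGroup H] [InnerProductSpace ℝ H] [RKHS ℝ H 𝓧 ℝ]
variable {K : ℕ} {m : Fin K → ℕ} (p : (Σ k : Fin K, Fin (m k)) → Measure 𝓧)

/-- The minimum inter-cluster distance `d_H` of the distribution clusters. -/
noncomputable def dH : ℝ :=
  minInter (fun a b => mmd H (p a) (p b)) (clustersOf fun a : (Σ k : Fin K, Fin (m k)) => a.1)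

/-- The maximum distance `d_I` of two sub-clusters that partition a distribution cluster. -/
noncomputable def dI : ℝ :=
  maxSub (fun a b => mmd H (p a) (p b)) (clustersOf fun a : (Σ k : Fin K, Fin (m k)) => a.1)

end Distributions

/-! ### Single linkage clustering of `M` points into `K` clusters -/

section Slink

variable {M : ℕ}

/-- The pairs of distinct clusters at minimum distance. -/
noncomputable def closestPairs (d : Fin M → Fin M → ℝ) (𝒞 : Finset (Finset (Fin M))) :
    Finset (Finset (Fin M) × Finset (Fin M)) :=
  𝒞.offDiag.filter fun q => ∀ q' ∈ 𝒞.offDiag, linkage d q.1 q.2 ≤ linkage d q'.1 q'.2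

/-- One step of single linkage clustering: two closest clusters are merged. The function `pick`
chooses one pair if several pairs of clusters are closest. -/
noncomputable def slinkStep
    (pick : Finset (Finset (Fin M) × Finset (Fin M)) → Finset (Fin M) × Finset (Fin M))
    (d : Fin M → Fin M → ℝ) (𝒞 : Finset (Finset (Fin M))) : Finset (Finset (Fin M)) :=
  let q := pick (closestPairs d 𝒞)
  insert (q.1 ∪ q.2) ((𝒞.erase q.1).erase q.2)

/-- Single linkage clustering: starting from the `M` singletons, two closest clusters are merged
until `K` clusters are left, that is, `M - K` times. -/
noncomputable def slink
    (pick : Finset (Finset (Fin M) × Finset (Fin M)) → Finset (Fin M) × Finset (Fin M))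
    (K : ℕ) (d : Fin M → Fin M → ℝ) : Finset (Finset (Fin M)) :=
  (slinkStep pick d)^[M - K] (Finset.univ.image fun i => {i})

end Slink

/-! ### The sequential algorithm

A sample point is `ω : Fin M × ℕ → 𝓧`; `ω (i, l)` is the sample number `l` of the `i`-th data
sequence (counted from `0`), so that the first `n` samples are those with `l < n`. -/

section Sequential

variable {𝓧 : Type*} {M : ℕ} (k : 𝓧 → 𝓧 → ℝ)
  (pick : Finset (Finset (Fin M) × Finset (Fin M)) → Finset (Fin M) × Finset (Fin M)) (K : ℕ)

/-- The estimated pairwise distances after `n` samples of each data sequence. -/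
noncomputable def dHat (n : ℕ) (ω : Fin M × ℕ → 𝓧) (i j : Fin M) : ℝ :=
  mmdEst k (fun l => ω (i, l)) (fun l => ω (j, l)) n

/-- The clustering `{C_1(n), …, C_K(n)}` after `n` samples of each data sequence. -/
noncomputable def clustersAt (n : ℕ) (ω : Fin M × ℕ → 𝓧) : Finset (Finset (Fin M)) :=
  slink pick K (dHat k n ω)

/-- The test statistic `Γ_n`, the minimum inter-cluster distance of the clustering after `n`
samples. -/
noncomputable def testStat (n : ℕ) (ω : Fin M × ℕ → 𝓧) : ℝ :=
  minInter (dHat k n ω) (clustersAt k pick K n ω)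

/-- The stopping time `N`, the first `n ≥ 2` with `Γ_n ≥ C / √n` (`⊤` if there is none). -/
noncomputable def stopTime (C : ℝ) (ω : Fin M × ℕ → 𝓧) : ℕ∞ :=
  ⨅ (n : ℕ) (_ : 2 ≤ n ∧ C / √(n : ℝ) ≤ testStat k pick K n ω), (n : ℕ∞)

variable {K}

/-- The error event: the final clustering is not the true one `P_k = {i : c i = k}`. Not stopping
at all counts as an error, too. -/
def errorEvent (C : ℝ) (c : Fin M → Fin K) : Set (Fin M × ℕ → 𝓧) :=
  {ω | ∀ n : ℕ, stopTime k pick K C ω = n → clustersAt k pick K n ω ≠ clustersOf c}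

variable [MeasurableSpace 𝓧] {m : Fin K → ℕ} (p : (Σ k : Fin K, Fin (m k)) → Measure 𝓧)

/-- The law of the data in the configuration `s`: all samples are independent, and those of the
`i`-th data sequence have the distribution `p (s i)`. -/
noncomputable def dataLaw [∀ a, IsProbabilityMeasure (p a)]
    (s : Fin M → Σ k : Fin K, Fin (m k)) : Measure (Fin M × ℕ → 𝓧) :=
  Measure.infinitePi fun il : Fin M × ℕ => p (s il.1)

/-- The expected number of samples `E[N]` in the configuration `s`. -/
noncomputable def expStopTime [∀ a, IsProbabilityMeasure (p a)] (C : ℝ)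
    (s : Fin M → Σ k : Fin K, Fin (m k)) : ℝ≥0∞ :=
  ∫⁻ ω, (stopTime k pick K C ω : ℝ≥0∞) ∂(dataLaw p s)

/-- The maximum error probability over all configurations, that is, over all assignments of the
distributions to the data sequences in which every distribution occurs. -/
noncomputable def pMax [∀ a, IsProbabilityMeasure (p a)] (C : ℝ) : ℝ≥0∞ :=
  ⨆ (s : Fin M → Σ k : Fin K, Fin (m k)) (_ : Function.Surjective s),
    dataLaw p s (errorEvent k pick C fun i => (s i).1)

end Sequential

end SlinkSeq

/-! Both sides of the asserted inequality are compared with `C²`: for every configuration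
`E[N] ≤ (C² / d_H²)(1 + o(1))`, while `P_max ≤ exp(-α₁ C²)` for all large `C`. As `α = α₁ d_H²`,
dividing gives the theorem.

*Concentration.* The estimate `d̂` is the distance of two empirical kernel mean embeddings, and
replacing one of the `2n` samples moves it by at most `√(2G) / n`. McDiarmid's inequality, proved
for an arbitrary product measure by integrating out one coordinate after the other
(`hasSubgaussianMGF_of_boundedDifferences`), bounds its fluctuations around its mean. The mean
exceeds the maximum mean discrepancy by at most `√(2G / n)`: it is not smaller since the estimate
dominates every unbiased linear test (`mmd_le_integral_dHat`), and its second moment is controlled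
by the double integral form of the maximum mean discrepancy (`integral_kern_le_mmd_sq`). Together,
a deviation by `ε` has probability at most `4 exp(-ε² n / (8G))`
(`measure_abs_dHat_sub_mmd_ge_le`). The rate is twice the one demanded by the theorem, which
leaves room for all polynomial factors. Only the kernel is assumed measurable, so the argument
avoids random elements of the Hilbert space.

*Single linkage.* Any partition other than the true one that has at least as many blocks splits
some true cluster, and every splitting is bridged by two sequences whose distributions are at
distance at most `d_I` (`exists_bridge`). If no estimate is off by `ε ≤ (d_H - d_I) / 2`, then
at every step two closest clusters lie in the same true cluster, so that the true clustering is
found with `Γ_n ≥ d_H - ε`. If the clustering is wrong, then `Γ_n` is at most the estimate of a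
distance that is truly at most `d_I`.

*Expectation.* Once `C / √n ≤ d_H - ε`, the algorithm runs on only after a deviation by `ε`, so
`E[N] ≤ C² / (d_H - ε)² + O(1)`, and `ε` is arbitrary (`eventually_expStopTime_le`).

*Error probability.* For `n < C² / ((1 - δ)² d_H²)`, stopping with a wrong clustering forces a
deviation by `C / √n - d_I`, which is at least `δ C / √n` because `d_I ≤ (1 - δ)² d_H`; for larger
`n`, a wrong clustering forces a deviation by `min (d_th - d_I) (d_H - d_th)`. The two ranges
contribute the two terms of the minimum `α₁` (`eventually_pMax_le`). -/

namespace SlinkSeq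

/-! ### McDiarmid's inequality on infinite product spaces -/

section BoundedDifferences

open ProbabilityTheory Function

variable {ι : Type*} {X : ι → Type*} [∀ i, MeasurableSpace (X i)]
  (μ : ∀ i, Measure (X i)) [∀ i, IsProbabilityMeasure (μ i)]

lemma integral_coordinate (a : ι) {g : X a → ℝ} (hg : Measurable g) :
    ∫ ω, g (ω a) ∂(Measure.infinitePi μ) = ∫ x, g x ∂(μ a) := by
  rw [← Measure.infinitePi_map_eval μ a,
    integral_map (measurable_pi_apply a).aemeasurable hg.aestronglyMeasurable]

variable [DecidableEq ι]

/-- Resampling one coordinate independently preserves the product measure. -/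
lemma measurePreserving_update (a : ι) :
    MeasurePreserving (fun z : (∀ i, X i) × X a => update z.1 a z.2)
      ((Measure.infinitePi μ).prod (μ a)) (Measure.infinitePi μ) := by
  refine ⟨measurable_update', Measure.eq_infinitePi μ fun s t ht => ?_⟩
  have hs : MeasurableSet (Set.pi (s : Set ι) t) :=
    MeasurableSet.pi s.countable_toSet fun i _ => ht i
  rw [Measure.map_apply measurable_update' hs]
  have hpre : (fun z : (∀ i, X i) × X a => update z.1 a z.2) ⁻¹' (Set.pi (s : Set ι) t)
      = (Set.pi ((s.erase a : Finset ι) : Set ι) t) ×ˢ (if a ∈ s then t a else Set.univ) := by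
    ext ⟨ω, x⟩
    simp only [Set.mem_preimage, Set.mem_pi, Finset.mem_coe, Set.mem_prod, Finset.mem_erase]
    constructor
    · intro h
      refine ⟨fun i hi => by simpa [hi.1] using h i hi.2, ?_⟩
      split_ifs with ha
      · simpa using h a ha
      · trivial
    · rintro ⟨h1, h2⟩ i hi
      by_cases hia : i = a
      · subst hia; simpa [hi] using h2
      · simpa [hia] using h1 i ⟨hia, hi⟩
  rw [hpre, Measure.prod_prod, Measure.infinitePi_pi μ fun i _ => ht i]
  split_ifs with ha
  · exact Finset.prod_erase_mul s (fun i => μ i (t i)) ha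
  · rw [Finset.erase_eq_of_notMem ha, measure_univ, mul_one]

lemma integral_update (a : ι) {F : (∀ i, X i) → ℝ} (hF : Integrable F (Measure.infinitePi μ)) :
    ∫ ω, ∫ x, F (update ω a x) ∂(μ a) ∂(Measure.infinitePi μ)
      = ∫ ω, F ω ∂(Measure.infinitePi μ) := by
  have h := measurePreserving_update μ a
  have hint : Integrable (fun z : (∀ i, X i) × X a => F (update z.1 a z.2))
      ((Measure.infinitePi μ).prod (μ a)) := h.integrable_comp_of_integrable hF
  rw [← integral_prod (fun z : (∀ i, X i) × X a => F (update z.1 a z.2)) hint]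
  have hF' : AEStronglyMeasurable F (((Measure.infinitePi μ).prod (μ a)).map
      (fun z : (∀ i, X i) × X a => update z.1 a z.2)) := by
    rw [h.map_eq]; exact hF.aestronglyMeasurable
  rw [← integral_map h.measurable.aemeasurable hF', h.map_eq]

lemma integral_two_coordinates {a b : ι} (hab : a ≠ b) {g : X a → X b → ℝ}
    (hg : Measurable fun z : X a × X b => g z.1 z.2) {B : ℝ} (hB : ∀ x y, |g x y| ≤ B) :
    ∫ ω, g (ω a) (ω b) ∂(Measure.infinitePi μ) = ∫ x, ∫ y, g x y ∂(μ b) ∂(μ a) := by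
  have hm : Measurable fun ω : (∀ i, X i) => g (ω a) (ω b) :=
    hg.comp ((measurable_pi_apply a).prodMk (measurable_pi_apply b))
  have hint : Integrable (fun ω : (∀ i, X i) => g (ω a) (ω b)) (Measure.infinitePi μ) :=
    Integrable.of_bound hm.aestronglyMeasurable B (ae_of_all _ fun ω => hB _ _)
  rw [← integral_update μ b hint, ← Measure.infinitePi_map_eval μ a,
    integral_map (measurable_pi_apply a).aemeasurable]
  · simp [update_of_ne hab]
  · exact (StronglyMeasurable.integral_prod_right (f := g)
      hg.stronglyMeasurable).aestronglyMeasurable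

lemma integrable_of_abs_le {Ω : Type*} [MeasurableSpace Ω] {ν : Measure Ω} [IsFiniteMeasure ν]
    {f : Ω → ℝ} (hf : Measurable f) {B : ℝ} (hB : ∀ ω, |f ω| ≤ B) : Integrable f ν :=
  Integrable.of_bound hf.aestronglyMeasurable B (ae_of_all _ hB)

/-- Hoeffding's lemma for a function of oscillation at most `c`. -/
lemma integral_exp_le_of_abs_sub_le {Ω : Type*} [MeasurableSpace Ω] {ν : Measure Ω}
    [IsProbabilityMeasure ν] {f : Ω → ℝ} (hf : Measurable f) {c : ℝ}
    (hc : ∀ x y, |f x - f y| ≤ c) (t : ℝ) :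
    ∫ x, Real.exp (t * (f x - ∫ y, f y ∂ν)) ∂ν ≤ Real.exp ((c / 2) ^ 2 * t ^ 2 / 2) := by
  obtain ⟨x₀⟩ : Nonempty Ω := nonempty_of_isProbabilityMeasure ν
  have hc0 : 0 ≤ c := (abs_nonneg _).trans (hc x₀ x₀)
  have hne : Nonempty Ω := ⟨x₀⟩
  have hbdd : BddBelow (Set.range f) := by
    refine ⟨f x₀ - c, ?_⟩
    rintro _ ⟨x, rfl⟩
    linarith [(abs_le.1 (hc x x₀)).1]
  have hmem : ∀ x, f x ∈ Set.Icc (⨅ y, f y) ((⨅ y, f y) + c) := fun x =>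
    ⟨ciInf_le hbdd x, by
      have : f x - c ≤ ⨅ y, f y := le_ciInf fun y => by linarith [(abs_le.1 (hc x y)).2]
      linarith⟩
  have h := (hasSubgaussianMGF_of_mem_Icc (μ := ν) hf.aemeasurable (ae_of_all _ hmem)).mgf_le t
  simpa [mgf, abs_of_nonneg hc0] using h

/-- By induction on the coordinates on which `F` depends: integrating out one of them keeps the
bounded differences in the others, and costs one factor from Hoeffding's lemma. -/
lemma integral_exp_le_of_boundedDifferences {c : ℝ} (t : ℝ) (S : Finset ι) :
    ∀ F : (∀ i, X i) → ℝ, Measurable F → (∃ B, ∀ ω, |F ω| ≤ B) → DependsOn F (S : Set ι) →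
      (∀ a ω x y, |F (update ω a x) - F (update ω a y)| ≤ c) →
      ∫ ω, Real.exp (t * (F ω - ∫ η, F η ∂(Measure.infinitePi μ))) ∂(Measure.infinitePi μ)
        ≤ Real.exp (S.card * (c / 2) ^ 2 * t ^ 2 / 2) := by
  induction S using Finset.induction_on with
  | empty =>
    intro F _ _ hdep _
    have hF : ∀ ω η, F ω = F η := fun ω η => hdep (by simp)
    have : ∀ ω, F ω - ∫ η, F η ∂(Measure.infinitePi μ) = 0 := fun ω => by
      simp_rw [fun η => hF η ω]; simp
    simp [this]
  | insert a S ha ih =>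
    intro F hF ⟨B, hB⟩ hdep hc
    set P := Measure.infinitePi μ with hP
    set E := ∫ η, F η ∂P with hE
    -- the conditional expectation of `F` given all coordinates but the `a`-th
    set F₁ : (∀ i, X i) → ℝ := fun ω => ∫ x, F (update ω a x) ∂(μ a) with hF₁
    have hFu : Measurable fun z : (∀ i, X i) × X a => F (update z.1 a z.2) :=
      hF.comp measurable_update'
    have hFω : ∀ ω, Measurable fun x => F (update ω a x) := fun ω =>
      hFu.comp measurable_prodMk_left
    have hi : ∀ ω, Integrable (fun x => F (update ω a x)) (μ a) := fun ω =>
      integrable_of_abs_le (hFω ω) fun x => hB _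
    have hF₁m : Measurable F₁ :=
      (StronglyMeasurable.integral_prod_right
        (f := fun ω x => F (update ω a x)) hFu.stronglyMeasurable).measurable
    have hF₁B : ∀ ω, |F₁ ω| ≤ B := fun ω => by
      have := norm_integral_le_of_norm_le_const (μ := μ a) (f := fun x => F (update ω a x))
        (C := B) (ae_of_all _ fun x => hB _)
      simpa using this
    have hE₁ : ∫ η, F₁ η ∂P = E := integral_update μ a (integrable_of_abs_le hF hB)
    have h₁ := ih F₁ hF₁m ⟨B, hF₁B⟩ (by
      intro ω η h
      refine integral_congr_ae (ae_of_all _ fun x => hdep fun i hi => ?_)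
      by_cases hia : i = a
      · subst hia; simp
      · have : i ∈ S := by simpa [hia] using hi
        simpa [hia] using h i this) (by
      intro b ω x y
      rw [hF₁, ← integral_sub (hi _) (hi _)]
      have := norm_integral_le_of_norm_le_const (μ := μ a)
        (f := fun z => F (update (update ω b x) a z) - F (update (update ω b y) a z)) (C := c)
        (ae_of_all _ fun z => by
          by_cases hba : b = a
          · subst hba
            simpa using (abs_nonneg _).trans (hc b ω x x)
          · rw [update_comm hba, update_comm hba]
            exact hc b _ x y)
      simpa using this)
    rw [hE₁] at h₁
    have hexp : ∀ {f : (∀ i, X i) → ℝ}, Measurable f → (∀ ω, |f ω| ≤ B) →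
        Integrable (fun ω => Real.exp (t * (f ω - E))) P := fun {f} hf hfB => by
      refine integrable_of_abs_le (B := Real.exp (|t| * (B + |E|))) (by fun_prop) fun ω => ?_
      rw [Real.abs_exp, Real.exp_le_exp]
      refine (le_abs_self _).trans ?_
      rw [abs_mul]
      gcongr
      exact (abs_sub _ _).trans (by gcongr; exact hfB ω)
    calc ∫ ω, Real.exp (t * (F ω - E)) ∂P
        = ∫ ω, ∫ x, Real.exp (t * (F (update ω a x) - E)) ∂(μ a) ∂P :=
          (integral_update μ a (hexp hF hB)).symm
      _ ≤ ∫ ω, Real.exp ((c / 2) ^ 2 * t ^ 2 / 2) * Real.exp (t * (F₁ ω - E)) ∂P := by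
          refine integral_mono_of_nonneg (ae_of_all _ fun ω => by positivity)
            ((hexp hF₁m hF₁B).const_mul _) (ae_of_all _ fun ω => ?_)
          have h := integral_exp_le_of_abs_sub_le (ν := μ a) (hFω ω) (hc a ω) t
          calc ∫ x, Real.exp (t * (F (update ω a x) - E)) ∂(μ a)
              = ∫ x, Real.exp (t * (F (update ω a x) - F₁ ω)) * Real.exp (t * (F₁ ω - E))
                  ∂(μ a) := by
                congr 1; ext x; rw [← Real.exp_add]; congr 1; ring
            _ = (∫ x, Real.exp (t * (F (update ω a x) - F₁ ω)) ∂(μ a))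
                  * Real.exp (t * (F₁ ω - E)) := integral_mul_const _ _
            _ ≤ _ := mul_le_mul_of_nonneg_right h (Real.exp_pos _).le
      _ = Real.exp ((c / 2) ^ 2 * t ^ 2 / 2) * ∫ ω, Real.exp (t * (F₁ ω - E)) ∂P :=
          integral_const_mul _ _
      _ ≤ Real.exp ((c / 2) ^ 2 * t ^ 2 / 2)
            * Real.exp (S.card * (c / 2) ^ 2 * t ^ 2 / 2) := by gcongr
      _ = Real.exp ((insert a S).card * (c / 2) ^ 2 * t ^ 2 / 2) := by
          rw [← Real.exp_add, Finset.card_insert_of_notMem ha]; push_cast; congr 1; ring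

/-- **McDiarmid's inequality**, as a bound on the moment generating function. -/
theorem hasSubgaussianMGF_of_boundedDifferences {F : (∀ i, X i) → ℝ} (hF : Measurable F)
    {B : ℝ} (hB : ∀ ω, |F ω| ≤ B) {S : Finset ι} (hdep : DependsOn F (S : Set ι)) {c : ℝ}
    (hc : ∀ a ω x y, |F (update ω a x) - F (update ω a y)| ≤ c) :
    HasSubgaussianMGF (fun ω => F ω - ∫ η, F η ∂(Measure.infinitePi μ))
      (S.card * (c / 2).toNNReal ^ 2) (Measure.infinitePi μ) where
  integrable_exp_mul t := by
    refine integrable_of_abs_le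
      (B := Real.exp (|t| * (B + |∫ η, F η ∂(Measure.infinitePi μ)|))) (by fun_prop) fun ω => ?_
    rw [Real.abs_exp, Real.exp_le_exp]
    refine (le_abs_self _).trans ?_
    rw [abs_mul]
    gcongr
    exact (abs_sub _ _).trans (add_le_add_left (hB ω) _)
  mgf_le t := by
    obtain ⟨ω⟩ : Nonempty (∀ i, X i) := nonempty_of_isProbabilityMeasure (Measure.infinitePi μ)
    rcases isEmpty_or_nonempty ι with hι | ⟨⟨a⟩⟩
    · have hS : S.card = 0 := by simp [Finset.eq_empty_of_isEmpty]
      have h := integral_exp_le_of_boundedDifferences μ (c := 0) t S F hF ⟨B, hB⟩ hdep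
        (fun a => isEmptyElim a)
      simpa [mgf, hS] using h
    · have hc0 : 0 ≤ c / 2 := by
        have := (abs_nonneg _).trans (hc a ω (ω a) (ω a))
        positivity
      have h := integral_exp_le_of_boundedDifferences μ t S F hF ⟨B, hB⟩ hdep hc
      simpa [mgf, Real.coe_toNNReal _ hc0] using h

end BoundedDifferences

/-! ### Kernel mean embeddings -/

section Embedding

open scoped InnerProductSpace

variable {𝓧 : Type*} (H : Type*) [NormedAddCommGroup H] [InnerProductSpace ℝ H] [CompleteSpace H]
  [RKHS ℝ H 𝓧 ℝ]

/-- The feature map `x ↦ k(·, x)` of the reproducing kernel Hilbert space. -/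
noncomputable def feature (x : 𝓧) : H := RKHS.kerFun H x (1 : ℝ)

variable {H}

lemma inner_feature (f : H) (x : 𝓧) : ⟪f, feature H x⟫_ℝ = f x := by
  simp [feature]

lemma kern_eq_inner (x y : 𝓧) : kern H x y = ⟪feature H x, feature H y⟫_ℝ := by
  have h := RKHS.kernel_inner H x y (1 : ℝ) (1 : ℝ)
  rw [real_inner_comm, feature, feature, ← h]
  simp [kern]

lemma feature_apply (x y : 𝓧) : (feature H x) y = kern H x y := by
  rw [kern_eq_inner, inner_feature]

lemma kern_symm (x y : 𝓧) : kern H x y = kern H y x := by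
  rw [kern_eq_inner, kern_eq_inner, real_inner_comm]

lemma norm_feature_sub_sq (x y : 𝓧) :
    ‖feature H x - feature H y‖ ^ 2 = kern H x x + kern H y y - 2 * kern H x y := by
  rw [norm_sub_sq_real, ← real_inner_self_eq_norm_sq, ← real_inner_self_eq_norm_sq,
    ← kern_eq_inner, ← kern_eq_inner, ← kern_eq_inner]
  ring

lemma norm_sq_empirical_embedding_sub (x y : ℕ → 𝓧) (n : ℕ) :
    ‖(1 / (n : ℝ)) • ∑ l ∈ Finset.range n, (feature H (x l) - feature H (y l))‖ ^ 2
      = (1 / (n : ℝ) ^ 2) * ∑ l ∈ Finset.range n, ∑ m ∈ Finset.range n,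
        (kern H (x l) (x m) + kern H (y l) (y m) - 2 * kern H (x l) (y m)) := by
  rw [← real_inner_self_eq_norm_sq, real_inner_smul_left, real_inner_smul_right, sum_inner]
  simp_rw [inner_sum, inner_sub_left, inner_sub_right, ← kern_eq_inner]
  have h : ∑ l ∈ Finset.range n, ∑ m ∈ Finset.range n, kern H (y l) (x m)
      = ∑ l ∈ Finset.range n, ∑ m ∈ Finset.range n, kern H (x l) (y m) := by
    rw [Finset.sum_comm]
    simp_rw [kern_symm (H := H) (y _) (x _)]
  simp_rw [Finset.sum_sub_distrib, Finset.sum_add_distrib, ← Finset.mul_sum, h]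
  ring

/-- The estimated distance is the distance of the empirical kernel mean embeddings. -/
lemma mmdEst_eq_norm (x y : ℕ → 𝓧) (n : ℕ) :
    mmdEst (kern H) x y n
      = ‖(1 / (n : ℝ)) • ∑ l ∈ Finset.range n, (feature H (x l) - feature H (y l))‖ := by
  rw [mmdEst, ← norm_sq_empirical_embedding_sub, Real.sqrt_sq (norm_nonneg _)]

variable {G : ℝ} (hk : ∀ x y : 𝓧, 0 ≤ kern H x y ∧ kern H x y ≤ G)

include hk in
lemma norm_feature_le (x : 𝓧) : ‖feature H x‖ ≤ √G := by
  rw [norm_eq_sqrt_real_inner, ← kern_eq_inner]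
  exact Real.sqrt_le_sqrt (hk x x).2

include hk in
lemma norm_feature_sub_le (x y : 𝓧) : ‖feature H x - feature H y‖ ≤ √(2 * G) := by
  refine Real.le_sqrt_of_sq_le ?_
  rw [norm_feature_sub_sq]
  linarith [(hk x x).2, (hk y y).2, (hk x y).1]

include hk in
lemma abs_apply_le (f : H) (x : 𝓧) : |f x| ≤ ‖f‖ * √G := by
  rw [← inner_feature]
  exact (abs_real_inner_le_norm _ _).trans (by gcongr; exact norm_feature_le hk x)

variable [MeasurableSpace 𝓧]
  (hmeas : Measurable fun z : 𝓧 × 𝓧 => kern H z.1 z.2)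

include hmeas in
/-- Finite combinations of kernel sections are measurable, and every element of the space is a
norm limit, hence a pointwise limit, of such combinations. -/
lemma measurable_apply (f : H) : Measurable fun x : 𝓧 => f x := by
  have hspan : ∀ g ∈ Submodule.span ℝ {RKHS.kerFun H x v | (x : 𝓧) (v : ℝ)},
      Measurable fun x : 𝓧 => g x := by
    intro g hg
    induction hg using Submodule.span_induction with
    | mem g hg =>
      obtain ⟨y, v, rfl⟩ := hg
      have hv : RKHS.kerFun H y v = v • feature H y := by
        rw [feature, ← map_smul]; simp
      rw [hv]
      simp only [RKHS.coe_smul, Pi.smul_apply, feature_apply, smul_eq_mul]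
      exact (hmeas.comp measurable_prodMk_left).const_mul v
    | zero => simp
    | add g g' _ _ h h' => simp only [RKHS.coe_add]; exact h.add h'
    | smul c g _ h => simpa using h.const_mul c
  have hf : f ∈ (Submodule.span ℝ {RKHS.kerFun H x v | (x : 𝓧) (v : ℝ)}).topologicalClosure := by
    rw [RKHS.kerFun_dense]; trivial
  obtain ⟨u, hu, hlim⟩ := mem_closure_iff_seq_limit.1 hf
  refine measurable_of_tendsto_metrizable (fun n => hspan (u n) (hu n)) ?_
  rw [tendsto_pi_nhds]
  exact fun x => ((RKHS.continuous_eval x).tendsto f).comp hlim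

include hk hmeas in
lemma integrable_apply (f : H) (p : Measure 𝓧) [IsFiniteMeasure p] :
    Integrable (fun x => f x) p :=
  integrable_of_abs_le (measurable_apply hmeas f) (abs_apply_le hk f)

include hk in
lemma abs_integral_sub_le (f : H) (p q : Measure 𝓧) [IsProbabilityMeasure p]
    [IsProbabilityMeasure q] : |(∫ x, f x ∂p) - ∫ y, f y ∂q| ≤ 2 * √G * ‖f‖ := by
  have h : ∀ (r : Measure 𝓧) [IsProbabilityMeasure r], |∫ x, f x ∂r| ≤ ‖f‖ * √G := fun r _ => by
    have := norm_integral_le_of_norm_le_const (μ := r) (f := fun x => f x)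
      (C := ‖f‖ * √G) (ae_of_all _ fun x => abs_apply_le hk f x)
    simpa using this
  exact (abs_sub _ _).trans (by linarith [h p, h q])

include hk in
lemma bddAbove_range_mmd (p q : Measure 𝓧) [IsProbabilityMeasure p] [IsProbabilityMeasure q] :
    BddAbove (Set.range fun f : Metric.closedBall (0 : H) 1 =>
      (∫ x, (f : H) x ∂p) - ∫ y, (f : H) y ∂q) := by
  refine ⟨2 * √G, ?_⟩
  rintro _ ⟨⟨f, hf⟩, rfl⟩
  have hf' : ‖f‖ ≤ 1 := by simpa using hf
  refine ((le_abs_self _).trans (abs_integral_sub_le hk f p q)).trans ?_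
  have : 0 ≤ 2 * √G := by positivity
  nlinarith

include hk in
lemma le_mmd (p q : Measure 𝓧) [IsProbabilityMeasure p] [IsProbabilityMeasure q] {f : H}
    (hf : ‖f‖ ≤ 1) : (∫ x, f x ∂p) - ∫ y, f y ∂q ≤ mmd H p q :=
  le_ciSup (bddAbove_range_mmd hk p q) ⟨f, by simpa using hf⟩

omit [CompleteSpace H] in
lemma mmd_le (p q : Measure 𝓧) {B : ℝ}
    (hB : ∀ f : H, ‖f‖ ≤ 1 → (∫ x, f x ∂p) - ∫ y, f y ∂q ≤ B) : mmd H p q ≤ B := by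
  have : Nonempty (Metric.closedBall (0 : H) 1) := ⟨⟨0, by simp⟩⟩
  exact ciSup_le fun f => hB f (mem_closedBall_zero_iff.1 f.2)

include hk in
lemma mmd_nonneg (p q : Measure 𝓧) [IsProbabilityMeasure p] [IsProbabilityMeasure q] :
    0 ≤ mmd H p q := by
  simpa using le_mmd hk p q (f := (0 : H)) (by simp)

omit [CompleteSpace H] in
lemma mmd_self (p : Measure 𝓧) : mmd H p p = 0 := by
  simp [mmd]

include hk in
lemma mmd_le_two_mul_sqrt (p q : Measure 𝓧) [IsProbabilityMeasure p] [IsProbabilityMeasure q] :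
    mmd H p q ≤ 2 * √G :=
  mmd_le p q fun f hf => ((le_abs_self _).trans (abs_integral_sub_le hk f p q)).trans
    (mul_le_of_le_one_right (by positivity) hf)

include hk hmeas in
/-- The squared maximum mean discrepancy dominates (in fact equals) its double integral form. The
functional `f ↦ E_p f - E_q f` is bounded; the left-hand side is the squared norm of its Riesz
representer `h`, and `h / ‖h‖` is a test function in the unit ball. -/
lemma integral_kern_le_mmd_sq (p q : Measure 𝓧) [IsProbabilityMeasure p]
    [IsProbabilityMeasure q] :
    (∫ x, ∫ y, kern H x y ∂p ∂p) + (∫ x, ∫ y, kern H x y ∂q ∂q)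
      - 2 * (∫ x, ∫ y, kern H x y ∂q ∂p) ≤ mmd H p q ^ 2 := by
  have hi := fun (f : H) (r : Measure 𝓧) (_ : IsProbabilityMeasure r) =>
    integrable_apply hk hmeas f r
  let L : H →L[ℝ] ℝ := LinearMap.mkContinuous
    { toFun := fun f => (∫ x, f x ∂p) - ∫ y, f y ∂q
      map_add' := fun f g => by
        simp only [RKHS.coe_add, Pi.add_apply]
        rw [integral_add (hi f p inferInstance) (hi g p inferInstance),
          integral_add (hi f q inferInstance) (hi g q inferInstance)]
        ring
      map_smul' := fun c f => by
        simp only [RKHS.coe_smul, Pi.smul_apply, smul_eq_mul, RingHom.id_apply]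
        rw [integral_const_mul, integral_const_mul]
        ring } (2 * √G) (fun f => abs_integral_sub_le hk f p q)
  have hL : ∀ f : H, L f = (∫ x, f x ∂p) - ∫ y, f y ∂q := fun f => rfl
  set h : H := (InnerProductSpace.toDual ℝ H).symm L with hh
  have hin : ∀ f : H, ⟪h, f⟫_ℝ = L f := fun f => InnerProductSpace.toDual_symm_apply
  have happ : ∀ x : 𝓧, h x = (∫ y, kern H x y ∂p) - ∫ y, kern H x y ∂q := fun x => by
    rw [← inner_feature, hin, hL]
    simp_rw [feature_apply]
  have hkm : ∀ x : 𝓧, ∀ y, |kern H x y| ≤ G := fun x y => by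
    rw [abs_of_nonneg (hk x y).1]; exact (hk x y).2
  have hii : ∀ (r r' : Measure 𝓧) [IsProbabilityMeasure r] [IsProbabilityMeasure r'],
      Integrable (fun x => ∫ y, kern H x y ∂r) r' := fun r r' _ _ => by
    refine integrable_of_abs_le (B := G) (StronglyMeasurable.integral_prod_right
      (f := fun x y => kern H x y) hmeas.stronglyMeasurable).measurable fun x => ?_
    have := norm_integral_le_of_norm_le_const (μ := r) (f := fun y => kern H x y)
      (C := G) (ae_of_all _ fun y => hkm x y)
    simpa using this
  have hswap : ∫ x, ∫ y, kern H x y ∂p ∂q = ∫ x, ∫ y, kern H x y ∂q ∂p := by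
    rw [integral_integral_swap (integrable_of_abs_le hmeas fun z => hkm z.1 z.2)]
    simp_rw [fun x y : 𝓧 => kern_symm (H := H) x y]
  have hnorm : ‖h‖ ^ 2 = (∫ x, ∫ y, kern H x y ∂p ∂p) + (∫ x, ∫ y, kern H x y ∂q ∂q)
      - 2 * (∫ x, ∫ y, kern H x y ∂q ∂p) := by
    rw [← real_inner_self_eq_norm_sq, hin, hL]
    simp_rw [happ]
    rw [integral_sub (hii p p) (hii q p), integral_sub (hii p q) (hii q q), hswap]
    ring
  rw [← hnorm]
  refine pow_le_pow_left₀ (norm_nonneg _) ?_ 2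
  rcases eq_or_ne h 0 with h0 | h0
  · rw [h0, norm_zero]; exact mmd_nonneg hk p q
  · have hpos : 0 < ‖h‖ := norm_pos_iff.2 h0
    calc ‖h‖ = L (‖h‖⁻¹ • h) := by
          rw [map_smul, ← hin, real_inner_self_eq_norm_sq, smul_eq_mul]
          field_simp
      _ ≤ mmd H p q := le_mmd hk p q (by
          rw [norm_smul, norm_inv, norm_norm, inv_mul_cancel₀ hpos.ne'])

end Embedding

/-! ### Concentration of the estimated distances -/

section Concentration

open ProbabilityTheory Function
open scoped InnerProductSpace

variable {𝓧 : Type*} [MeasurableSpace 𝓧] {H : Type*} [NormedAddCommGroup H]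
  [InnerProductSpace ℝ H] [CompleteSpace H] [RKHS ℝ H 𝓧 ℝ]
  {G : ℝ} (hk : ∀ x y : 𝓧, 0 ≤ kern H x y ∧ kern H x y ≤ G)
  (hmeas : Measurable fun z : 𝓧 × 𝓧 => kern H z.1 z.2) {M : ℕ}

omit [MeasurableSpace 𝓧] in
lemma dHat_eq_norm (n : ℕ) (ω : Fin M × ℕ → 𝓧) (i j : Fin M) :
    dHat (kern H) n ω i j
      = ‖(1 / (n : ℝ)) • ∑ l ∈ Finset.range n, (feature H (ω (i, l)) - feature H (ω (j, l)))‖ :=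
  mmdEst_eq_norm _ _ n

omit [MeasurableSpace 𝓧] in
lemma dHat_nonneg (n : ℕ) (ω : Fin M × ℕ → 𝓧) (i j : Fin M) : 0 ≤ dHat (kern H) n ω i j :=
  Real.sqrt_nonneg _

omit [MeasurableSpace 𝓧] in
lemma dHat_self (n : ℕ) (ω : Fin M × ℕ → 𝓧) (i : Fin M) : dHat (kern H) n ω i i = 0 := by
  rw [dHat_eq_norm]; simp

lemma measurable_dHat {k : 𝓧 → 𝓧 → ℝ} (hm : Measurable fun z : 𝓧 × 𝓧 => k z.1 z.2) (n : ℕ)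
    (i j : Fin M) : Measurable fun ω : Fin M × ℕ → 𝓧 => dHat k n ω i j := by
  have h : ∀ a b : Fin M × ℕ, Measurable fun ω : Fin M × ℕ → 𝓧 => k (ω a) (ω b) :=
    fun a b => hm.comp (g := fun z : 𝓧 × 𝓧 => k z.1 z.2)
      (f := fun ω : Fin M × ℕ → 𝓧 => (ω a, ω b))
      ((measurable_pi_apply a).prodMk (measurable_pi_apply b))
  unfold dHat mmdEst
  refine Measurable.sqrt (Measurable.const_mul ?_ _)
  refine Finset.measurable_fun_sum _ fun l _ => Finset.measurable_fun_sum _ fun m _ => ?_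
  exact ((h (i, l) (i, m)).add (h (j, l) (j, m))).sub ((h (i, l) (j, m)).const_mul 2)

include hk in
omit [MeasurableSpace 𝓧] in
lemma dHat_le (n : ℕ) (ω : Fin M × ℕ → 𝓧) (i j : Fin M) :
    dHat (kern H) n ω i j ≤ √(2 * G) := by
  rw [dHat_eq_norm, norm_smul, Real.norm_of_nonneg (by positivity)]
  rcases n.eq_zero_or_pos with rfl | hn
  · simp
  have hn' : (0 : ℝ) < n := by exact_mod_cast hn
  have h := norm_sum_le_of_le (Finset.range n)
    (f := fun l => feature H (ω (i, l)) - feature H (ω (j, l)))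
    fun l _ => norm_feature_sub_le hk (ω (i, l)) (ω (j, l))
  rw [Finset.sum_const, Finset.card_range, nsmul_eq_mul] at h
  rw [div_mul_eq_mul_div, one_mul, div_le_iff₀ hn']
  linarith

include hk in
omit [MeasurableSpace 𝓧] in
/-- Replacing one sample changes the empirical mean embeddings by at most `√(2G) / n`. -/
lemma abs_dHat_update_sub_le {n : ℕ} {i j : Fin M} (hij : i ≠ j)
    (a : Fin M × ℕ) (ω : Fin M × ℕ → 𝓧) (x y : 𝓧) :
    |dHat (kern H) n (update ω a x) i j - dHat (kern H) n (update ω a y) i j|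
      ≤ √(2 * G) / n := by
  rw [dHat_eq_norm, dHat_eq_norm]
  refine (abs_norm_sub_norm_le _ _).trans ?_
  rw [← smul_sub, norm_smul, Real.norm_of_nonneg (by positivity), div_mul_eq_mul_div, one_mul]
  refine div_le_div_of_nonneg_right ?_ (by positivity)
  set δ : Fin M × ℕ → H := fun b => feature H (update ω a x b) - feature H (update ω a y b)
  have hδ : ∀ b, ‖δ b‖ ≤ if b = a then √(2 * G) else 0 := fun b => by
    split_ifs with hb
    · exact norm_feature_sub_le hk _ _
    · simp [δ, hb]
  calc ‖∑ l ∈ Finset.range n, (feature H (update ω a x (i, l)) - feature H (update ω a x (j, l)))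
        - ∑ l ∈ Finset.range n,
          (feature H (update ω a y (i, l)) - feature H (update ω a y (j, l)))‖
      = ‖∑ l ∈ Finset.range n, (δ (i, l) - δ (j, l))‖ := by
        rw [← Finset.sum_sub_distrib]
        congr 1
        refine Finset.sum_congr rfl fun l _ => ?_
        simp only [δ]; abel
    _ ≤ ∑ l ∈ Finset.range n, (‖δ (i, l)‖ + ‖δ (j, l)‖) :=
        norm_sum_le_of_le _ fun l _ => norm_sub_le _ _
    _ = ∑ b ∈ ({i, j} : Finset (Fin M)) ×ˢ Finset.range n, ‖δ b‖ := by
        rw [Finset.sum_product, Finset.sum_pair hij, Finset.sum_add_distrib]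
    _ ≤ ∑ b ∈ ({i, j} : Finset (Fin M)) ×ˢ Finset.range n, if b = a then √(2 * G) else 0 :=
        Finset.sum_le_sum fun b _ => hδ b
    _ ≤ √(2 * G) := by
        rw [Finset.sum_ite_eq']
        split_ifs
        · exact le_rfl
        · positivity

variable (ν : Fin M → Measure 𝓧) [∀ i, IsProbabilityMeasure (ν i)]

/-- The law of independent samples, those of the `i`-th sequence having the distribution `ν i`. -/
noncomputable abbrev sampleLaw : Measure (Fin M × ℕ → 𝓧) :=
  Measure.infinitePi fun il : Fin M × ℕ => ν il.1

include hk hmeas in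
lemma integrable_dHat (n : ℕ) (i j : Fin M) :
    Integrable (fun ω => dHat (kern H) n ω i j) (sampleLaw ν) :=
  integrable_of_abs_le (measurable_dHat hmeas n i j) fun ω => by
    rw [abs_of_nonneg (dHat_nonneg n ω i j)]; exact dHat_le hk n ω i j

include hk hmeas in
/-- Tested against a fixed element of the unit ball, the empirical mean embeddings are unbiased,
so that the estimate overestimates the maximum mean discrepancy on average. -/
lemma mmd_le_integral_dHat {n : ℕ} (hn : 1 ≤ n) (i j : Fin M) :
    mmd H (ν i) (ν j) ≤ ∫ ω, dHat (kern H) n ω i j ∂(sampleLaw ν) := by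
  refine mmd_le _ _ fun f hf => ?_
  have hn' : (n : ℝ) ≠ 0 := by positivity
  have hfi : ∀ a : Fin M × ℕ, Integrable (fun ω : Fin M × ℕ → 𝓧 => f (ω a)) (sampleLaw ν) :=
    fun a => integrable_of_abs_le ((measurable_apply hmeas f).comp (measurable_pi_apply a))
      fun ω => abs_apply_le hk f _
  have hfv : ∀ a : Fin M × ℕ, ∫ ω, f (ω a) ∂(sampleLaw ν) = ∫ x, f x ∂(ν a.1) := fun a =>
    integral_coordinate (fun il : Fin M × ℕ => ν il.1) a (measurable_apply hmeas f)
  have hfs : ∀ l : ℕ, Integrable (fun ω : Fin M × ℕ → 𝓧 => f (ω (i, l)) - f (ω (j, l)))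
      (sampleLaw ν) := fun l => (hfi _).sub (hfi _)
  calc (∫ x, f x ∂(ν i)) - ∫ y, f y ∂(ν j)
      = ∫ ω, (1 / (n : ℝ)) * ∑ l ∈ Finset.range n, (f (ω (i, l)) - f (ω (j, l)))
          ∂(sampleLaw ν) := by
        rw [integral_const_mul, integral_finsetSum _ fun l _ => hfs l]
        simp_rw [integral_sub (hfi _) (hfi _), hfv]
        simp
        field_simp
    _ ≤ _ := by
        refine integral_mono (Integrable.const_mul
          (integrable_finsetSum _ fun l _ => hfs l) _)
          (integrable_dHat hk hmeas ν n i j) fun ω => ?_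
        have h : (1 / (n : ℝ)) * ∑ l ∈ Finset.range n, (f (ω (i, l)) - f (ω (j, l)))
            = ⟪f, (1 / (n : ℝ)) • ∑ l ∈ Finset.range n,
                (feature H (ω (i, l)) - feature H (ω (j, l)))⟫_ℝ := by
          rw [real_inner_smul_right, inner_sum]
          simp_rw [inner_sub_right, inner_feature]
        simp only
        rw [h, dHat_eq_norm]
        exact (real_inner_le_norm _ _).trans (mul_le_of_le_one_left (norm_nonneg _) hf)

/-- The off-diagonal terms of the squared estimate are unbiased; its `n` diagonal terms are
bounded by `2G`. -/
lemma integral_sum_kernel_le {k : 𝓧 → 𝓧 → ℝ} (hm : Measurable fun z : 𝓧 × 𝓧 => k z.1 z.2)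
    (hk : ∀ x y, 0 ≤ k x y ∧ k x y ≤ G) {n : ℕ} (hn : 1 ≤ n) {i j : Fin M} (hij : i ≠ j) {D : ℝ}
    (hD0 : 0 ≤ D) (hD : (∫ x, ∫ y, k x y ∂(ν i) ∂(ν i)) + (∫ x, ∫ y, k x y ∂(ν j) ∂(ν j))
      - 2 * (∫ x, ∫ y, k x y ∂(ν j) ∂(ν i)) ≤ D) :
    ∫ ω, (1 / (n : ℝ) ^ 2) * ∑ l ∈ Finset.range n, ∑ m ∈ Finset.range n, (k (ω (i, l)) (ω (i, m))
        + k (ω (j, l)) (ω (j, m)) - 2 * k (ω (i, l)) (ω (j, m))) ∂(sampleLaw ν)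
      ≤ D + 2 * G / n := by
  have hn' : (0 : ℝ) < n := by positivity
  have habs : ∀ x y : 𝓧, |k x y| ≤ G := fun x y => by
    rw [abs_of_nonneg (hk x y).1]; exact (hk x y).2
  have hki : ∀ a b : Fin M × ℕ,
      Integrable (fun ω : Fin M × ℕ → 𝓧 => k (ω a) (ω b)) (sampleLaw ν) := fun a b =>
    integrable_of_abs_le (hm.comp (g := fun z : 𝓧 × 𝓧 => k z.1 z.2)
      (f := fun ω : Fin M × ℕ → 𝓧 => (ω a, ω b))
      ((measurable_pi_apply a).prodMk (measurable_pi_apply b)))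
      fun ω => habs _ _
  have hkv : ∀ a b : Fin M × ℕ, a ≠ b → ∫ ω, k (ω a) (ω b) ∂(sampleLaw ν)
      = ∫ x, ∫ y, k x y ∂(ν b.1) ∂(ν a.1) := fun a b hab =>
    integral_two_coordinates (fun il : Fin M × ℕ => ν il.1) hab hm habs
  have hti : ∀ l m : ℕ, Integrable (fun ω : Fin M × ℕ → 𝓧 => k (ω (i, l)) (ω (i, m))
      + k (ω (j, l)) (ω (j, m)) - 2 * k (ω (i, l)) (ω (j, m))) (sampleLaw ν) :=
    fun l m => ((hki (i, l) (i, m)).add (hki (j, l) (j, m))).sub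
      ((hki (i, l) (j, m)).const_mul 2)
  have hterm : ∀ l m : ℕ, ∫ ω, (k (ω (i, l)) (ω (i, m)) + k (ω (j, l)) (ω (j, m))
        - 2 * k (ω (i, l)) (ω (j, m))) ∂(sampleLaw ν) ≤ D + if l = m then 2 * G else 0 := by
    intro l m
    split_ifs with hlm
    · calc _ ≤ ∫ _ : Fin M × ℕ → 𝓧, 2 * G ∂(sampleLaw ν) :=
            integral_mono (hti l m) (integrable_const _) fun ω => by
              have h1 := (hk (ω (i, l)) (ω (i, m))).2
              have h2 := (hk (ω (j, l)) (ω (j, m))).2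
              have h3 := (hk (ω (i, l)) (ω (j, m))).1
              simp only
              linarith
        _ ≤ _ := by
            simp only [integral_const, probReal_univ, one_smul]
            linarith
    · have hadd : Integrable (fun ω : Fin M × ℕ → 𝓧 => k (ω (i, l)) (ω (i, m))
          + k (ω (j, l)) (ω (j, m))) (sampleLaw ν) := (hki (i, l) (i, m)).add (hki (j, l) (j, m))
      rw [integral_sub hadd ((hki (i, l) (j, m)).const_mul 2),
        integral_add (hki (i, l) (i, m)) (hki (j, l) (j, m)), integral_const_mul,
        hkv _ _ (by simpa using hlm),
        hkv _ _ (by simpa using hlm), hkv _ _ (by simp [hij]), add_zero]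
      exact hD
  rw [integral_const_mul,
    integral_finsetSum _ fun l _ => integrable_finsetSum _ fun m _ => hti l m]
  simp_rw [integral_finsetSum (Finset.range n) fun m _ => hti _ m]
  calc _ ≤ (1 / (n : ℝ) ^ 2) * ∑ l ∈ Finset.range n, ∑ m ∈ Finset.range n,
        (D + if l = m then 2 * G else 0) := by
        gcongr with l _ m _
        exact hterm l m
    _ = (1 / (n : ℝ) ^ 2) * ((n : ℝ) ^ 2 * D + n * (2 * G)) := by
        congr 1
        simp_rw [Finset.sum_add_distrib, Finset.sum_ite_eq]
        rw [Finset.sum_ite_of_true (fun l hl => hl)]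
        simp
        ring
    _ = _ := by field_simp

include hk hmeas in
lemma integral_dHat_sq_le {n : ℕ} (hn : 1 ≤ n) {i j : Fin M} (hij : i ≠ j) :
    ∫ ω, dHat (kern H) n ω i j ^ 2 ∂(sampleLaw ν) ≤ mmd H (ν i) (ν j) ^ 2 + 2 * G / n := by
  refine le_trans (le_of_eq (integral_congr_ae (ae_of_all _ fun ω => ?_)))
    (integral_sum_kernel_le ν hmeas hk hn hij (sq_nonneg _)
      (integral_kern_le_mmd_sq hk hmeas (ν i) (ν j)))
  simp only
  rw [dHat_eq_norm, norm_sq_empirical_embedding_sub (fun l => ω (i, l)) (fun l => ω (j, l))]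

include hk hmeas in
lemma integral_dHat_le {n : ℕ} (hn : 1 ≤ n) {i j : Fin M} (hij : i ≠ j) :
    ∫ ω, dHat (kern H) n ω i j ∂(sampleLaw ν) ≤ mmd H (ν i) (ν j) + √(2 * G / n) := by
  have hD := mmd_nonneg hk (ν i) (ν j)
  have hG : 0 ≤ 2 * G / n := by
    obtain ⟨x⟩ := nonempty_of_isProbabilityMeasure (ν i)
    have := (hk x x).1.trans (hk x x).2
    positivity
  have hmem : MemLp (fun ω => dHat (kern H) n ω i j) 2 (sampleLaw ν) :=
    MemLp.of_bound (measurable_dHat hmeas n i j).aestronglyMeasurable (√(2 * G))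
      (ae_of_all _ fun ω => by
        rw [Real.norm_of_nonneg (dHat_nonneg n ω i j)]; exact dHat_le hk n ω i j)
  have hvar := variance_nonneg (fun ω => dHat (kern H) n ω i j) (sampleLaw ν)
  rw [variance_eq_sub hmem] at hvar
  have h2 := integral_dHat_sq_le hk hmeas ν hn hij
  simp only [Pi.pow_apply] at hvar
  refine abs_le_of_sq_le_sq' ?_ (by positivity) |>.2
  nlinarith [Real.sq_sqrt hG, Real.sqrt_nonneg (2 * G / n)]

include hk hmeas in
lemma hasSubgaussianMGF_dHat {n : ℕ} (hn : 1 ≤ n) {i j : Fin M} (hij : i ≠ j) :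
    HasSubgaussianMGF (fun ω => dHat (kern H) n ω i j
      - ∫ η, dHat (kern H) n η i j ∂(sampleLaw ν)) (G / n).toNNReal (sampleLaw ν) := by
  have hG : 0 ≤ G := by
    obtain ⟨x⟩ := nonempty_of_isProbabilityMeasure (ν i)
    exact (hk x x).1.trans (hk x x).2
  have h := hasSubgaussianMGF_of_boundedDifferences (fun il : Fin M × ℕ => ν il.1)
    (F := fun ω => dHat (kern H) n ω i j) (measurable_dHat hmeas n i j)
    (B := √(2 * G)) (fun ω => by
      rw [abs_of_nonneg (dHat_nonneg n ω i j)]; exact dHat_le hk n ω i j)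
    (S := ({i, j} : Finset (Fin M)) ×ˢ Finset.range n) (by
      intro ω η h
      simp only [dHat_eq_norm]
      congr 2
      refine Finset.sum_congr rfl fun l hl => ?_
      have hl' : l < n := Finset.mem_range.1 hl
      rw [h (i, l) (by simp [hl']), h (j, l) (by simp [hl'])])
    (c := √(2 * G) / n) (fun a ω x y => abs_dHat_update_sub_le hk hij a ω x y)
  convert h using 1
  have hn' : (n : ℝ) ≠ 0 := by positivity
  ext
  push_cast
  rw [Finset.card_product, Finset.card_pair hij, Finset.card_range,
    Real.coe_toNNReal _ (by positivity), Real.coe_toNNReal _ (by positivity)]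
  push_cast
  rw [div_pow, div_pow, Real.sq_sqrt (by positivity)]
  field_simp

include hk hmeas in
/-- Concentration of the estimated distance around the maximum mean discrepancy. Halving the
deviation absorbs the bias `√(2G / n)`, unless the deviation is so small that the bound exceeds
one. -/
lemma measure_abs_dHat_sub_mmd_ge_le {n : ℕ} (hn : 1 ≤ n) (hG : 0 < G) (i j : Fin M) {ε : ℝ}
    (hε : 0 ≤ ε) :
    (sampleLaw ν) {ω | ε ≤ |dHat (kern H) n ω i j - mmd H (ν i) (ν j)|}
      ≤ ENNReal.ofReal (4 * Real.exp (-(ε ^ 2 * n / (8 * G)))) := by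
  have hn' : (0 : ℝ) < n := by positivity
  rw [← ENNReal.ofReal_toReal (measure_ne_top (sampleLaw ν) _), ← measureReal_def]
  refine ENNReal.ofReal_le_ofReal ?_
  by_cases hsmall : ε ^ 2 * n / (8 * G) ≤ 1
  · refine measureReal_le_one.trans ?_
    have h1 : Real.exp (-1) ≤ Real.exp (-(ε ^ 2 * n / (8 * G))) :=
      Real.exp_le_exp.2 (by linarith)
    have h2 : 1 / 4 ≤ Real.exp (-1) := by
      rw [Real.exp_neg, ← one_div]
      exact one_div_le_one_div_of_le (Real.exp_pos 1) (by linarith [Real.exp_one_lt_d9])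
    linarith
  have hε8 : 8 * G < ε ^ 2 * n := by
    rw [not_le, lt_div_iff₀ (by positivity)] at hsmall; linarith
  have hεpos : 0 < ε := by
    rcases hε.eq_or_lt with rfl | h
    · simp at hε8; linarith
    · exact h
  rcases eq_or_ne i j with rfl | hij
  · have : {ω : Fin M × ℕ → 𝓧 | ε ≤ |dHat (kern H) n ω i i - mmd H (ν i) (ν i)|} = ∅ := by
      ext ω; simp [dHat_self, mmd_self, hεpos]
    rw [this, measureReal_empty]; positivity
  set E := ∫ η, dHat (kern H) n η i j ∂(sampleLaw ν) with hE
  have hsub := hasSubgaussianMGF_dHat hk hmeas ν hn hij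
  have hlow := mmd_le_integral_dHat hk hmeas ν hn i j
  have hup := integral_dHat_le hk hmeas ν hn hij
  have hbias : √(2 * G / n) ≤ ε / 2 := by
    refine Real.sqrt_le_iff.2 ⟨by positivity, ?_⟩
    rw [div_le_iff₀ hn']; linarith
  have hexp : Real.exp (-(ε / 2) ^ 2 / (2 * ((G / n).toNNReal : ℝ)))
      = Real.exp (-(ε ^ 2 * n / (8 * G))) := by
    rw [Real.coe_toNNReal _ (by positivity)]
    congr 1
    field_simp
    ring
  have h1 := hsub.measure_ge_le (ε := ε / 2) (by positivity)
  have h2 := hsub.neg.measure_ge_le (ε := ε / 2) (by positivity)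
  rw [hexp] at h1 h2
  calc (sampleLaw ν).real {ω | ε ≤ |dHat (kern H) n ω i j - mmd H (ν i) (ν j)|}
      ≤ (sampleLaw ν).real ({ω | ε / 2 ≤ dHat (kern H) n ω i j - E}
          ∪ {ω | ε / 2 ≤ (-fun ω => dHat (kern H) n ω i j - E) ω}) := by
        refine measureReal_mono fun ω hω => ?_
        simp only [Set.mem_ofPred_eq, le_abs] at hω
        rcases hω with h | h
        · left; simp only [Set.mem_ofPred_eq]; linarith
        · right; simp only [Set.mem_ofPred_eq, Pi.neg_apply]; linarith
    _ ≤ Real.exp (-(ε ^ 2 * n / (8 * G))) + Real.exp (-(ε ^ 2 * n / (8 * G))) :=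
        (measureReal_union_le _ _).trans (add_le_add h1 h2)
    _ ≤ _ := by linarith [Real.exp_pos (-(ε ^ 2 * n / (8 * G)))]

end Concentration

/-! ### Single linkage clustering -/

section ClusterDistances

variable {ι : Type*} (d : ι → ι → ℝ)

lemma finite_linkage (A B : Finset ι) : {r | ∃ i ∈ A, ∃ j ∈ B, r = d i j}.Finite := by
  refine (((A ×ˢ B).finite_toSet).image fun q => d q.1 q.2).subset ?_
  rintro _ ⟨i, hi, j, hj, rfl⟩
  exact ⟨(i, j), by simp [hi, hj], rfl⟩

lemma linkage_le {A B : Finset ι} {i j : ι} (hi : i ∈ A) (hj : j ∈ B) :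
    linkage d A B ≤ d i j :=
  csInf_le (finite_linkage d A B).bddBelow ⟨i, hi, j, hj, rfl⟩

lemma exists_linkage_eq {A B : Finset ι} (hA : A.Nonempty) (hB : B.Nonempty) :
    ∃ i ∈ A, ∃ j ∈ B, linkage d A B = d i j := by
  obtain ⟨i, hi⟩ := hA
  obtain ⟨j, hj⟩ := hB
  have hne : {r | ∃ i ∈ A, ∃ j ∈ B, r = d i j}.Nonempty := ⟨_, i, hi, j, hj, rfl⟩
  exact hne.csInf_mem (finite_linkage d A B)

lemma finite_minInter (𝒞 : Finset (Finset ι)) :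
    {r | ∃ A ∈ 𝒞, ∃ B ∈ 𝒞, A ≠ B ∧ r = linkage d A B}.Finite := by
  refine (((𝒞 ×ˢ 𝒞).finite_toSet).image fun q => linkage d q.1 q.2).subset ?_
  rintro _ ⟨A, hA, B, hB, -, rfl⟩
  exact ⟨(A, B), by simp [hA, hB], rfl⟩

lemma minInter_le {𝒞 : Finset (Finset ι)} {A B : Finset ι} (hA : A ∈ 𝒞) (hB : B ∈ 𝒞)
    (hAB : A ≠ B) {i j : ι} (hi : i ∈ A) (hj : j ∈ B) : minInter d 𝒞 ≤ d i j :=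
  (csInf_le (finite_minInter d 𝒞).bddBelow ⟨A, hA, B, hB, hAB, rfl⟩).trans (linkage_le d hi hj)

lemma le_minInter {𝒞 : Finset (Finset ι)} (h𝒞 : 𝒞.Nontrivial) (hne : ∀ A ∈ 𝒞, A.Nonempty) {r : ℝ}
    (hr : ∀ A ∈ 𝒞, ∀ B ∈ 𝒞, A ≠ B → ∀ i ∈ A, ∀ j ∈ B, r ≤ d i j) : r ≤ minInter d 𝒞 := by
  obtain ⟨A, hA, B, hB, hAB⟩ := h𝒞
  refine le_csInf ⟨_, A, hA, B, hB, hAB, rfl⟩ ?_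
  rintro _ ⟨A, hA, B, hB, hAB, rfl⟩
  obtain ⟨i, hi, j, hj, h⟩ := exists_linkage_eq d (hne A hA) (hne B hB)
  rw [h]
  exact hr A hA B hB hAB i hi j hj

variable [DecidableEq ι]

lemma le_maxSub [Finite ι] {𝒞 : Finset (Finset ι)} {A B : Finset ι} (hA : A.Nonempty)
    (hB : B.Nonempty) (hAB : A ∩ B = ∅) (h𝒞 : A ∪ B ∈ 𝒞) : linkage d A B ≤ maxSub d 𝒞 := by
  refine le_csSup (Set.Finite.bddAbove ((Set.finite_range
    fun q : Finset ι × Finset ι => linkage d q.1 q.2).subset ?_))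
    ⟨_, h𝒞, A, B, hA, hB, rfl, hAB, rfl⟩
  rintro _ ⟨_, -, A, B, -, -, -, -, rfl⟩
  exact ⟨(A, B), rfl⟩

lemma maxSub_nonneg (hd : ∀ i j, 0 ≤ d i j) (𝒞 : Finset (Finset ι)) : 0 ≤ maxSub d 𝒞 := by
  refine Real.sSup_nonneg ?_
  rintro _ ⟨_, -, A, B, -, -, -, -, rfl⟩
  refine Real.sInf_nonneg ?_
  rintro _ ⟨i, -, j, -, rfl⟩
  exact hd i j

end ClusterDistances

section Partitions

variable {ι : Type*}

/-- A finite set of finite sets that partitions the whole type into nonempty blocks. -/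
structure IsPartition (𝒞 : Finset (Finset ι)) : Prop where
  nonempty : ∀ A ∈ 𝒞, A.Nonempty
  cover : ∀ i, ∃ A ∈ 𝒞, i ∈ A
  eq_of_mem : ∀ A ∈ 𝒞, ∀ B ∈ 𝒞, ∀ i, i ∈ A → i ∈ B → A = B

/-- A partition with more blocks than labels splits a label class. -/
lemma exists_split_of_lt_card {K : ℕ} {c : ι → Fin K} {𝒞 : Finset (Finset ι)}
    (h𝒞 : IsPartition 𝒞) (hcard : K < 𝒞.card) :
    ∃ A ∈ 𝒞, ∃ i ∈ A, ∃ j, j ∉ A ∧ c i = c j := by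
  have hrep : ∀ A : Finset ι, A ∈ 𝒞 → ∃ i, i ∈ A := fun A hA => h𝒞.nonempty A hA
  have hne : Nonempty ι := by
    obtain ⟨A, hA⟩ := Finset.card_pos.1 (Nat.zero_lt_of_lt hcard)
    exact ⟨(h𝒞.nonempty A hA).choose⟩
  choose! f hf using hrep
  obtain ⟨A, hA, B, hB, hAB, hlab⟩ := Finset.exists_ne_map_eq_of_card_lt_of_maps_to
    (t := (Finset.univ : Finset (Fin K))) (by simpa using hcard) (f := fun A => c (f A))
    (fun A _ => Finset.mem_univ _)
  exact ⟨A, hA, f A, hf A hA, f B,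
    fun h => hAB (h𝒞.eq_of_mem A hA B hB (f B) h (hf B hB)), hlab⟩

/-- A partition that refines another one and has no more blocks is equal to it. -/
lemma IsPartition.eq_of_refines {𝒞 𝒟 : Finset (Finset ι)} (h𝒞 : IsPartition 𝒞)
    (h𝒟 : IsPartition 𝒟) (href : ∀ A ∈ 𝒞, ∃ B ∈ 𝒟, A ⊆ B) (hcard : 𝒞.card ≤ 𝒟.card) : 𝒞 = 𝒟 := by
  choose! f hf𝒟 hf using href
  have hmem : ∀ A ∈ 𝒞, ∀ B ∈ 𝒟, ∀ i, i ∈ A → i ∈ B → f A = B := fun A hA B hB i hiA hiB =>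
    h𝒟.eq_of_mem _ (hf𝒟 A hA) B hB i (hf A hA hiA) hiB
  have hsurj : ∀ B ∈ 𝒟, ∃ A ∈ 𝒞, f A = B := fun B hB => by
    obtain ⟨i, hi⟩ := h𝒟.nonempty B hB
    obtain ⟨A, hA, hiA⟩ := h𝒞.cover i
    exact ⟨A, hA, hmem A hA B hB i hiA hi⟩
  have hinj : Set.InjOn f 𝒞 :=
    Finset.injOn_of_surjOn_of_card_le f (fun A hA => hf𝒟 A hA)
      (fun B hB => by simpa using hsurj B hB) hcard
  have hfA : ∀ A ∈ 𝒞, f A = A := fun A hA => by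
    refine Finset.Subset.antisymm (fun j hj => ?_) (hf A hA)
    obtain ⟨A', hA', hj'⟩ := h𝒞.cover j
    have := hmem A' hA' (f A) (hf𝒟 A hA) j hj' hj
    rwa [hinj hA' hA this] at hj'
  ext B
  constructor
  · intro hB
    rw [← hfA B hB]; exact hf𝒟 B hB
  · intro hB
    obtain ⟨A, hA, rfl⟩ := hsurj B hB
    rwa [hfA A hA]

variable [DecidableEq ι]

lemma IsPartition.merge {𝒞 : Finset (Finset ι)} (h : IsPartition 𝒞) {A B : Finset ι} (hA : A ∈ 𝒞)
    (hB : B ∈ 𝒞) : IsPartition (insert (A ∪ B) ((𝒞.erase A).erase B)) where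
  nonempty D hD := by
    rcases Finset.mem_insert.1 hD with rfl | hD
    · exact (h.nonempty A hA).mono Finset.subset_union_left
    · exact h.nonempty D (Finset.mem_of_mem_erase (Finset.mem_of_mem_erase hD))
  cover i := by
    obtain ⟨D, hD, hi⟩ := h.cover i
    by_cases hDA : D = A ∨ D = B
    · refine ⟨A ∪ B, Finset.mem_insert_self _ _, ?_⟩
      rcases hDA with rfl | rfl <;> simp [hi]
    · push Not at hDA
      exact ⟨D, by simp [hDA, hD], hi⟩
  eq_of_mem := by
    have key : ∀ D ∈ (𝒞.erase A).erase B, ∀ i ∈ A ∪ B, i ∉ D := by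
      intro D hD i hi hiD
      simp only [Finset.mem_erase] at hD
      rcases Finset.mem_union.1 hi with hi | hi
      · exact hD.2.1 (h.eq_of_mem D hD.2.2 A hA i hiD hi)
      · exact hD.1 (h.eq_of_mem D hD.2.2 B hB i hiD hi)
    intro D hD E hE i hiD hiE
    rcases Finset.mem_insert.1 hD with rfl | hD <;> rcases Finset.mem_insert.1 hE with rfl | hE
    · rfl
    · exact (key E hE i hiD hiE).elim
    · exact (key D hD i hiE hiD).elim
    · exact h.eq_of_mem D (Finset.mem_of_mem_erase (Finset.mem_of_mem_erase hD)) E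
        (Finset.mem_of_mem_erase (Finset.mem_of_mem_erase hE)) i hiD hiE

lemma IsPartition.card_merge {𝒞 : Finset (Finset ι)} (h : IsPartition 𝒞) {A B : Finset ι}
    (hA : A ∈ 𝒞) (hB : B ∈ 𝒞) (hAB : A ≠ B) :
    (insert (A ∪ B) ((𝒞.erase A).erase B)).card = 𝒞.card - 1 := by
  have hnot : A ∪ B ∉ (𝒞.erase A).erase B := by
    intro hmem
    simp only [Finset.mem_erase] at hmem
    obtain ⟨i, hi⟩ := h.nonempty A hA
    exact hmem.2.1 (h.eq_of_mem _ hmem.2.2 A hA i (by simp [hi]) hi)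
  have hB' : B ∈ 𝒞.erase A := Finset.mem_erase.2 ⟨hAB.symm, hB⟩
  have hpos : 0 < (𝒞.erase A).card := Finset.card_pos.2 ⟨B, hB'⟩
  have h1 := Finset.card_erase_of_mem hA
  have h2 := Finset.card_erase_of_mem hB'
  rw [Finset.card_insert_of_notMem hnot]
  omega

variable [Fintype ι]

lemma isPartition_singletons :
    IsPartition (Finset.univ.image fun i : ι => ({i} : Finset ι)) where
  nonempty := by simp
  cover i := ⟨{i}, by simp, by simp⟩
  eq_of_mem := by simp

variable {K : ℕ} {c : ι → Fin K}

lemma isPartition_clustersOf (hc : Function.Surjective c) : IsPartition (clustersOf c) where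
  nonempty := by
    intro A hA
    obtain ⟨k, -, rfl⟩ := Finset.mem_image.1 hA
    obtain ⟨i, hi⟩ := hc k
    exact ⟨i, by simp [hi]⟩
  cover i := ⟨_, Finset.mem_image_of_mem _ (Finset.mem_univ (c i)), by simp⟩
  eq_of_mem := by
    intro A hA B hB i hiA hiB
    obtain ⟨k, -, rfl⟩ := Finset.mem_image.1 hA
    obtain ⟨l, -, rfl⟩ := Finset.mem_image.1 hB
    simp only [Finset.mem_filter, Finset.mem_univ, true_and] at hiA hiB
    rw [← hiA, ← hiB]

lemma card_clustersOf (hc : Function.Surjective c) : (clustersOf c).card = K := by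
  rw [clustersOf, Finset.card_image_of_injective, Finset.card_univ, Fintype.card_fin]
  intro k l hkl
  obtain ⟨i, rfl⟩ := hc k
  have : i ∈ Finset.univ.filter fun j => c j = l := by
    simp only at hkl
    rw [← hkl]; simp
  simpa using this

/-- A partition into `K` blocks other than the one given by the labelling splits a label class. -/
lemma exists_split_of_ne_clustersOf (hc : Function.Surjective c) {𝒞 : Finset (Finset ι)}
    (h𝒞 : IsPartition 𝒞) (hcard : K ≤ 𝒞.card) (hne : 𝒞 ≠ clustersOf c) :
    ∃ A ∈ 𝒞, ∃ i ∈ A, ∃ j, j ∉ A ∧ c i = c j := by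
  by_contra! hcon
  refine hne ((isPartition_clustersOf hc).eq_of_refines h𝒞 (fun D hD => ?_)
    ((card_clustersOf hc).trans_le hcard)).symm
  obtain ⟨i, hi⟩ := (isPartition_clustersOf hc).nonempty D hD
  obtain ⟨A, hA, hiA⟩ := h𝒞.cover i
  refine ⟨A, hA, fun j hj => ?_⟩
  by_contra hjA
  refine hcon A hA i hiA j hjA ?_
  obtain ⟨k, -, rfl⟩ := Finset.mem_image.1 hD
  simp only [Finset.mem_filter, Finset.mem_univ, true_and] at hi hj
  rw [hi, hj]

end Partitions

section SlinkCorrectness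

variable {M K : ℕ}
  {pick : Finset (Finset (Fin M) × Finset (Fin M)) → Finset (Fin M) × Finset (Fin M)}
  (hpick : ∀ t, t.Nonempty → pick t ∈ t) (d : Fin M → Fin M → ℝ)

include hpick in
lemma pick_closestPairs_mem {𝒞 : Finset (Finset (Fin M))} (h : 1 < 𝒞.card) :
    pick (closestPairs d 𝒞) ∈ closestPairs d 𝒞 := by
  refine hpick _ ?_
  obtain ⟨A, hA, B, hB, hAB⟩ := Finset.one_lt_card.1 h
  obtain ⟨q, hq, hmin⟩ := Finset.exists_min_image 𝒞.offDiag (fun q => linkage d q.1 q.2)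
    ⟨(A, B), Finset.mem_offDiag.2 ⟨hA, hB, hAB⟩⟩
  exact ⟨q, Finset.mem_filter.2 ⟨hq, hmin⟩⟩

include hpick in
/-- Induction principle for single linkage clustering: besides an arbitrary property preserved by
the merging steps, the final clustering is a partition into `K` blocks. -/
lemma slink_induction (hK : 1 ≤ K) (hKM : K ≤ M) {Q : Finset (Finset (Fin M)) → Prop}
    (h0 : Q (Finset.univ.image fun i => {i}))
    (hstep : ∀ 𝒞, IsPartition 𝒞 → K < 𝒞.card → Q 𝒞 → Q (slinkStep pick d 𝒞)) :
    IsPartition (slink pick K d) ∧ (slink pick K d).card = K ∧ Q (slink pick K d) := by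
  have key : ∀ t ≤ M - K, IsPartition ((slinkStep pick d)^[t] (Finset.univ.image fun i => {i})) ∧
      ((slinkStep pick d)^[t] (Finset.univ.image fun i => {i})).card = M - t ∧
      Q ((slinkStep pick d)^[t] (Finset.univ.image fun i => {i})) := by
    intro t
    induction t with
    | zero =>
      intro _
      refine ⟨isPartition_singletons, ?_, h0⟩
      rw [Function.iterate_zero, id, Finset.card_image_of_injective _ Finset.singleton_injective]
      simp
    | succ t ih =>
      intro ht
      obtain ⟨h1, h2, h3⟩ := ih (by omega)
      rw [Function.iterate_succ_apply']
      set 𝒞 := (slinkStep pick d)^[t] (Finset.univ.image fun i => {i})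
      have hq := (Finset.mem_filter.1 (pick_closestPairs_mem hpick d (𝒞 := 𝒞) (by omega))).1
      rw [Finset.mem_offDiag] at hq
      refine ⟨h1.merge hq.1 hq.2.1, ?_, hstep 𝒞 h1 (by omega) h3⟩
      rw [slinkStep, h1.card_merge hq.1 hq.2.1 hq.2.2]
      omega
  obtain ⟨h1, h2, h3⟩ := key (M - K) le_rfl
  exact ⟨h1, by rw [slink, h2]; omega, h3⟩

include hpick in
/-- Single linkage clustering recovers the labelling if every splitting of a label class is bridged
by a distance below the threshold `θ` while different classes are at least `θ` apart. -/
lemma slink_eq_clustersOf (hK : 1 ≤ K) (hKM : K ≤ M) {c : Fin M → Fin K}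
    (hc : Function.Surjective c) {θ : ℝ}
    (hsplit : ∀ A : Finset (Fin M), ∀ i ∈ A, ∀ j, j ∉ A → c i = c j →
      ∃ i' ∈ A, ∃ j', j' ∉ A ∧ d i' j' < θ)
    (hsep : ∀ i j, c i ≠ c j → θ ≤ d i j) : slink pick K d = clustersOf c := by
  obtain ⟨hpart, hcard, hQ⟩ := slink_induction hpick d hK hKM
    (Q := fun 𝒞 => ∀ A ∈ 𝒞, ∀ i ∈ A, ∀ j ∈ A, c i = c j) (by
      intro A hA i hi j hj
      obtain ⟨l, -, rfl⟩ := Finset.mem_image.1 hA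
      rw [Finset.mem_singleton.1 hi, Finset.mem_singleton.1 hj]) (by
    intro 𝒞 h𝒞 hcard hQ
    have hq := Finset.mem_filter.1 (pick_closestPairs_mem hpick d (𝒞 := 𝒞) (by omega))
    set q := pick (closestPairs d 𝒞) with hqdef
    obtain ⟨hoff, hmin⟩ := hq
    rw [Finset.mem_offDiag] at hoff
    -- some label class is split by `𝒞`, so the closest pair is closer than `θ`
    obtain ⟨A, hA, i, hi, j, hj, hij⟩ := exists_split_of_lt_card (c := c) h𝒞 hcard
    obtain ⟨i', hi', j', hj', hlt⟩ := hsplit A i hi j hj hij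
    obtain ⟨B, hB, hjB⟩ := h𝒞.cover j'
    have hAB : A ≠ B := fun h => hj' (h ▸ hjB)
    have hle := hmin (A, B) (Finset.mem_offDiag.2 ⟨hA, hB, hAB⟩)
    obtain ⟨u, hu, v, hv, huv⟩ :=
      exists_linkage_eq d (h𝒞.nonempty _ hoff.1) (h𝒞.nonempty _ hoff.2.1)
    have hcuv : c u = c v := by
      by_contra hne
      have h1 := hsep u v hne
      have h2 := linkage_le d hi' hjB
      simp only at hle
      linarith
    have hQu : ∀ w ∈ q.1 ∪ q.2, c w = c u := fun w hw => by
      rcases Finset.mem_union.1 hw with hw | hw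
      · exact hQ q.1 hoff.1 w hw u hu
      · rw [hcuv]; exact hQ q.2 hoff.2.1 w hw v hv
    intro D hD
    rw [slinkStep, ← hqdef, Finset.mem_insert] at hD
    rcases hD with rfl | hD
    · exact fun i hi j hj => (hQu i hi).trans (hQu j hj).symm
    · exact hQ D (Finset.mem_of_mem_erase (Finset.mem_of_mem_erase hD)))
  refine hpart.eq_of_refines (isPartition_clustersOf hc) (fun A hA => ?_)
    (by rw [hcard, card_clustersOf hc])
  obtain ⟨i, hi⟩ := hpart.nonempty A hA
  exact ⟨_, Finset.mem_image_of_mem _ (Finset.mem_univ (c i)), fun j hj => by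
    simpa using hQ A hA j hj i hi⟩

include hpick in
/-- If single linkage clustering errs, its minimum inter-cluster distance is bounded by a distance
that bridges a splitting of a label class. -/
lemma exists_minInter_slink_le (hK : 1 ≤ K) (hKM : K ≤ M) {c : Fin M → Fin K}
    (hc : Function.Surjective c) {R : Fin M → Fin M → Prop}
    (hsplit : ∀ A : Finset (Fin M), ∀ i ∈ A, ∀ j, j ∉ A → c i = c j →
      ∃ i' ∈ A, ∃ j', j' ∉ A ∧ R i' j')
    (hne : slink pick K d ≠ clustersOf c) :
    ∃ i j, R i j ∧ minInter d (slink pick K d) ≤ d i j := by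
  obtain ⟨hpart, hcard, -⟩ := slink_induction hpick d hK hKM (Q := fun _ => True) trivial
    (fun _ _ _ _ => trivial)
  obtain ⟨A, hA, i, hi, j, hj, hij⟩ := exists_split_of_ne_clustersOf hc hpart hcard.ge hne
  obtain ⟨i', hi', j', hj', hR⟩ := hsplit A i hi j hj hij
  obtain ⟨B, hB, hjB⟩ := hpart.cover j'
  exact ⟨i', j', hR, minInter_le d hA hB (fun h => hj' (h ▸ hjB)) hi' hjB⟩

end SlinkCorrectness

section DistributionClusters

variable {K : ℕ} {m : Fin K → ℕ} (D : (Σ k : Fin K, Fin (m k)) → (Σ k : Fin K, Fin (m k)) → ℝ)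

lemma minInter_clusters_le {a b : Σ k : Fin K, Fin (m k)} (hab : a.1 ≠ b.1) :
    minInter D (clustersOf fun a : (Σ k : Fin K, Fin (m k)) => a.1) ≤ D a b := by
  have hmem : ∀ k, (Finset.univ.filter fun x : (Σ k : Fin K, Fin (m k)) => x.1 = k)
      ∈ clustersOf fun a : (Σ k : Fin K, Fin (m k)) => a.1 := fun k =>
    Finset.mem_image_of_mem _ (Finset.mem_univ k)
  refine minInter_le D (hmem a.1) (hmem b.1) (fun h => hab ?_) (by simp) (by simp)
  have : a ∈ Finset.univ.filter fun x : (Σ k : Fin K, Fin (m k)) => x.1 = b.1 := by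
    rw [← h]; simp
  simpa using this

/-- Every splitting of a true cluster of data sequences is bridged by two sequences whose
distributions are at distance at most `d_I`: either the same distribution occurs on both sides, or
the splitting induces one of the distribution cluster. -/
lemma exists_bridge (hD : ∀ a b, 0 ≤ D a b) (hD0 : ∀ a, D a a = 0) {ι : Type*} [Fintype ι]
    [DecidableEq ι] {s : ι → Σ k : Fin K, Fin (m k)} (hs : Function.Surjective s) (A : Finset ι)
    {i j : ι} (hi : i ∈ A) (hj : j ∉ A) (hij : (s i).1 = (s j).1) :
    ∃ i' ∈ A, ∃ j', j' ∉ A ∧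
      D (s i') (s j') ≤ maxSub D (clustersOf fun a : (Σ k : Fin K, Fin (m k)) => a.1) := by
  set U := (A.filter fun l => (s l).1 = (s i).1).image s with hU
  set V := (Aᶜ.filter fun l => (s l).1 = (s i).1).image s with hV
  by_cases hUV : U ∩ V = ∅
  · have hUne : U.Nonempty := ⟨s i, Finset.mem_image_of_mem _ (by simp [hi])⟩
    have hVne : V.Nonempty := ⟨s j, Finset.mem_image_of_mem _ (by simp [hj, hij])⟩
    have hunion : U ∪ V = Finset.univ.filter fun a => a.1 = (s i).1 := by
      ext a
      obtain ⟨l, rfl⟩ := hs a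
      simp only [hU, hV, Finset.mem_union, Finset.mem_image, Finset.mem_filter, Finset.mem_univ,
        true_and, Finset.mem_compl]
      constructor
      · rintro (⟨l', ⟨-, h1⟩, h2⟩ | ⟨l', ⟨-, h1⟩, h2⟩) <;> rw [← h2, h1]
      · intro h
        by_cases hl : l ∈ A
        · exact Or.inl ⟨l, ⟨hl, h⟩, rfl⟩
        · exact Or.inr ⟨l, ⟨hl, h⟩, rfl⟩
    have hle := le_maxSub D (𝒞 := clustersOf fun a : (Σ k : Fin K, Fin (m k)) => a.1) hUne hVne hUV
      (by rw [hunion]; exact Finset.mem_image_of_mem _ (Finset.mem_univ _))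
    obtain ⟨a, ha, b, hb, hab⟩ := exists_linkage_eq D hUne hVne
    obtain ⟨i', hi', rfl⟩ := Finset.mem_image.1 ha
    obtain ⟨j', hj', rfl⟩ := Finset.mem_image.1 hb
    rw [Finset.mem_filter] at hi' hj'
    exact ⟨i', hi'.1, j', by simpa using hj'.1, by rw [← hab]; exact hle⟩
  · obtain ⟨a, ha⟩ := Finset.nonempty_iff_ne_empty.2 hUV
    obtain ⟨ha1, ha2⟩ := Finset.mem_inter.1 ha
    obtain ⟨i', hi', rfl⟩ := Finset.mem_image.1 ha1
    obtain ⟨j', hj', hjeq⟩ := Finset.mem_image.1 ha2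
    rw [Finset.mem_filter] at hi' hj'
    refine ⟨i', hi'.1, j', by simpa using hj'.1, ?_⟩
    rw [hjeq, hD0]
    exact maxSub_nonneg D hD _

end DistributionClusters

/-! ### Events of the sequential algorithm -/

section Deviations

variable {𝓧 : Type*} [MeasurableSpace 𝓧] (H : Type*) [NormedAddCommGroup H]
  [InnerProductSpace ℝ H] [CompleteSpace H] [RKHS ℝ H 𝓧 ℝ] {M : ℕ} (ν : Fin M → Measure 𝓧)

/-- The event that after `n` samples some estimated distance is off by at least `ε`. -/
def deviation (n : ℕ) (ε : ℝ) : Set (Fin M × ℕ → 𝓧) :=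
  {ω | ∃ i j, ε ≤ |dHat (kern H) n ω i j - mmd H (ν i) (ν j)|}

variable {H}

lemma measurableSet_deviation (hmeas : Measurable fun z : 𝓧 × 𝓧 => kern H z.1 z.2) (n : ℕ)
    (ε : ℝ) : MeasurableSet (deviation H ν n ε) := by
  have : deviation H ν n ε = ⋃ i, ⋃ j, {ω | ε ≤ |dHat (kern H) n ω i j - mmd H (ν i) (ν j)|} := by
    ext ω; simp [deviation]
  rw [this]
  refine MeasurableSet.iUnion fun i => MeasurableSet.iUnion fun j => ?_
  exact measurableSet_le measurable_const ((measurable_dHat hmeas n i j).sub_const _).abs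

lemma measure_deviation_le {G : ℝ} (hk : ∀ x y : 𝓧, 0 ≤ kern H x y ∧ kern H x y ≤ G)
    (hmeas : Measurable fun z : 𝓧 × 𝓧 => kern H z.1 z.2) [∀ i, IsProbabilityMeasure (ν i)]
    (hG : 0 < G) {n : ℕ} (hn : 1 ≤ n) {ε : ℝ} (hε : 0 ≤ ε) :
    (sampleLaw ν) (deviation H ν n ε)
      ≤ ENNReal.ofReal (4 * (M : ℝ) ^ 2 * Real.exp (-(ε ^ 2 * n / (8 * G)))) := by
  have : deviation H ν n ε = ⋃ i, ⋃ j, {ω | ε ≤ |dHat (kern H) n ω i j - mmd H (ν i) (ν j)|} := by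
    ext ω; simp [deviation]
  rw [this]
  refine (measure_iUnion_fintype_le _ _).trans ?_
  calc ∑ i, (sampleLaw ν) (⋃ j, {ω | ε ≤ |dHat (kern H) n ω i j - mmd H (ν i) (ν j)|})
      ≤ ∑ _i : Fin M, ∑ _j : Fin M, ENNReal.ofReal (4 * Real.exp (-(ε ^ 2 * n / (8 * G)))) :=
        Finset.sum_le_sum fun i _ => (measure_iUnion_fintype_le _ _).trans
          (Finset.sum_le_sum fun j _ => measure_abs_dHat_sub_mmd_ge_le hk hmeas ν hn hG i j hε)
    _ = _ := by
        simp only [Finset.sum_const, Finset.card_univ, Fintype.card_fin, nsmul_eq_mul]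
        rw [← mul_assoc, ← ENNReal.ofReal_natCast, ← ENNReal.ofReal_mul (by positivity),
          ← ENNReal.ofReal_mul (by positivity)]
        congr 1
        ring

lemma tsum_ofReal_exp_neg_mul_add (A : ℝ) (hA : 0 ≤ A) {β : ℝ} (hβ : 0 < β) (n₀ : ℕ) :
    ∑' t : ℕ, ENNReal.ofReal (A * Real.exp (-(β * ((n₀ + t : ℕ) : ℝ))))
      = ENNReal.ofReal (A / (1 - Real.exp (-β)) * Real.exp (-(β * n₀))) := by
  have hq : Real.exp (-β) < 1 := by rw [Real.exp_lt_one_iff]; linarith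
  have hterm : ∀ t : ℕ, A * Real.exp (-(β * ((n₀ + t : ℕ) : ℝ)))
      = A * Real.exp (-(β * n₀)) * Real.exp (-β) ^ t := fun t => by
    rw [← Real.exp_nat_mul, mul_assoc, ← Real.exp_add]
    congr 2; push_cast; ring
  have hsum := (hasSum_geometric_of_lt_one (Real.exp_pos (-β)).le hq).mul_left
    (A * Real.exp (-(β * n₀)))
  simp_rw [hterm]
  rw [← ENNReal.ofReal_tsum_of_nonneg (fun t => by positivity) hsum.summable, hsum.tsum_eq]
  congr 1
  rw [div_eq_mul_inv]; ring

end Deviations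

section StoppingTime

variable {𝓧 : Type*} {M : ℕ} {k : 𝓧 → 𝓧 → ℝ}
  {pick : Finset (Finset (Fin M) × Finset (Fin M)) → Finset (Fin M) × Finset (Fin M)} {K : ℕ}

lemma stopTime_le {C : ℝ} {ω : Fin M × ℕ → 𝓧} {n : ℕ} (hn : 2 ≤ n)
    (h : C / √(n : ℝ) ≤ testStat k pick K n ω) : stopTime k pick K C ω ≤ n :=
  iInf₂_le n ⟨hn, h⟩

lemma of_stopTime_eq {C : ℝ} {ω : Fin M × ℕ → 𝓧} {n : ℕ} (h : stopTime k pick K C ω = n) :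
    2 ≤ n ∧ C / √(n : ℝ) ≤ testStat k pick K n ω := by
  by_contra hcon
  have hle : ((n + 1 : ℕ) : ℕ∞) ≤ stopTime k pick K C ω := by
    refine le_iInf₂ fun l hl => ?_
    have h1 : (n : ℕ∞) ≤ l := h ▸ stopTime_le hl.1 hl.2
    have h2 : n ≠ l := fun h => hcon (h ▸ hl)
    have h3 : n ≤ l := by exact_mod_cast h1
    exact_mod_cast lt_of_le_of_ne h3 h2
  rw [h] at hle
  have : n + 1 ≤ n := by exact_mod_cast hle
  omega

end StoppingTime

section Algorithm

variable {𝓧 : Type*} [MeasurableSpace 𝓧] {H : Type*} [NormedAddCommGroup H]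
  [InnerProductSpace ℝ H] [CompleteSpace H] [RKHS ℝ H 𝓧 ℝ]
  {G : ℝ} (hk : ∀ x y : 𝓧, 0 ≤ kern H x y ∧ kern H x y ≤ G)
  (hmeas : Measurable fun z : 𝓧 × 𝓧 => kern H z.1 z.2) {M K : ℕ} (hK : 2 ≤ K) {m : Fin K → ℕ}
  (hm : ∀ k, 1 ≤ m k) (p : (Σ k : Fin K, Fin (m k)) → Measure 𝓧) [∀ a, IsProbabilityMeasure (p a)]
  {pick : Finset (Finset (Fin M) × Finset (Fin M)) → Finset (Fin M) × Finset (Fin M)}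
  (hpick : ∀ t, t.Nonempty → pick t ∈ t)
  {s : Fin M → Σ k : Fin K, Fin (m k)} (hs : Function.Surjective s)

include hk in
lemma dI_nonneg : 0 ≤ dI H p := maxSub_nonneg _ (fun _ _ => mmd_nonneg hk _ _) _

omit [CompleteSpace H] [∀ a, IsProbabilityMeasure (p a)] in
lemma dH_le {a b : Σ k : Fin K, Fin (m k)} (hab : a.1 ≠ b.1) : dH H p ≤ mmd H (p a) (p b) :=
  minInter_clusters_le (fun a b => mmd H (p a) (p b)) hab

include hk hK hm in
lemma dH_le_two_mul_sqrt : dH H p ≤ 2 * √G := by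
  let a : Σ k : Fin K, Fin (m k) := ⟨⟨0, by omega⟩, ⟨0, hm _⟩⟩
  let b : Σ k : Fin K, Fin (m k) := ⟨⟨1, by omega⟩, ⟨0, hm _⟩⟩
  exact (dH_le p (a := a) (b := b) (by simp [a, b])).trans (mmd_le_two_mul_sqrt hk _ _)

include hm hs in
lemma surjective_label : Function.Surjective fun i => (s i).1 := fun l => by
  obtain ⟨i, hi⟩ := hs ⟨l, ⟨0, hm l⟩⟩
  exact ⟨i, congrArg Sigma.fst hi⟩

include hm hs in
lemma card_labels_le : K ≤ M := by
  simpa using Fintype.card_le_of_surjective _ (surjective_label hm hs)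

include hk hK hm hpick hs in
/-- When no estimated distance is off by `ε`, single linkage finds the true clusters. -/
lemma clustersAt_eq_of_notMem_deviation {n : ℕ} {ε : ℝ} (hε : dI H p + 2 * ε ≤ dH H p)
    {ω : Fin M × ℕ → 𝓧} (hω : ω ∉ deviation H (fun i => p (s i)) n ε) :
    clustersAt (kern H) pick K n ω = clustersOf fun i => (s i).1 := by
  have hdev : ∀ i j, |dHat (kern H) n ω i j - mmd H (p (s i)) (p (s j))| < ε := fun i j =>
    not_le.1 fun h => hω ⟨i, j, h⟩
  refine slink_eq_clustersOf hpick _ (by omega) (card_labels_le hm hs) (surjective_label hm hs)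
    (θ := dI H p + ε) (fun A i hi j hj hij => ?_) (fun i j hij => ?_)
  · obtain ⟨i', hi', j', hj', h⟩ := exists_bridge (fun a b => mmd H (p a) (p b))
      (fun _ _ => mmd_nonneg hk _ _) (fun _ => mmd_self _) hs A hi hj hij
    have h' : mmd H (p (s i')) (p (s j')) ≤ dI H p := h
    exact ⟨i', hi', j', hj', by linarith [(abs_lt.1 (hdev i' j')).2]⟩
  · have h := dH_le (H := H) p hij
    linarith [(abs_lt.1 (hdev i j)).1]

include hk hK hm hpick hs in
lemma le_testStat_of_notMem_deviation {n : ℕ} {ε : ℝ} (hε : dI H p + 2 * ε ≤ dH H p)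
    {ω : Fin M × ℕ → 𝓧} (hω : ω ∉ deviation H (fun i => p (s i)) n ε) :
    dH H p - ε ≤ testStat (kern H) pick K n ω := by
  rw [testStat, clustersAt_eq_of_notMem_deviation hk hK hm p hpick hs hε hω]
  have hc := surjective_label hm hs
  refine le_minInter _ ?_ (isPartition_clustersOf hc).nonempty ?_
  · rw [← Finset.one_lt_card_iff_nontrivial, card_clustersOf hc]; omega
  · intro A hA B hB hAB i hi j hj
    obtain ⟨a, -, rfl⟩ := Finset.mem_image.1 hA
    obtain ⟨b, -, rfl⟩ := Finset.mem_image.1 hB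
    simp only [Finset.mem_filter, Finset.mem_univ, true_and] at hi hj
    have hij : (s i).1 ≠ (s j).1 := fun h => hAB (by rw [← hi, ← hj, h])
    have hdev : |dHat (kern H) n ω i j - mmd H (p (s i)) (p (s j))| < ε :=
      not_le.1 fun h => hω ⟨i, j, h⟩
    linarith [(abs_lt.1 hdev).1, dH_le (H := H) p hij]

include hk hK hm hpick hs in
/-- Stopping with a wrong clustering requires that the distance of two sequences bridging a split
cluster, truly at most `d_I`, is estimated to be at least `C / √n`. -/
lemma mem_deviation_of_clustersAt_ne {n : ℕ} {C : ℝ} {ω : Fin M × ℕ → 𝓧}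
    (hne : clustersAt (kern H) pick K n ω ≠ clustersOf fun i => (s i).1)
    (hcross : C / √(n : ℝ) ≤ testStat (kern H) pick K n ω) :
    ω ∈ deviation H (fun i => p (s i)) n (C / √(n : ℝ) - dI H p) := by
  obtain ⟨i, j, hR, hle⟩ := exists_minInter_slink_le hpick (dHat (kern H) n ω) (by omega)
    (card_labels_le hm hs) (surjective_label hm hs)
    (R := fun i j => mmd H (p (s i)) (p (s j)) ≤ dI H p)
    (fun A i hi j hj hij => exists_bridge (fun a b => mmd H (p a) (p b))
      (fun _ _ => mmd_nonneg hk _ _) (fun _ => mmd_self _) hs A hi hj hij) hne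
  refine ⟨i, j, le_trans ?_ (le_abs_self _)⟩
  have : testStat (kern H) pick K n ω ≤ dHat (kern H) n ω i j := hle
  linarith

include hk hK hm hpick hs in
lemma stopTime_le_of_notMem_deviation {n : ℕ} (hn : 2 ≤ n) {C ε : ℝ}
    (hε : dI H p + 2 * ε ≤ dH H p) (hC : C / √(n : ℝ) ≤ dH H p - ε) {ω : Fin M × ℕ → 𝓧}
    (hω : ω ∉ deviation H (fun i => p (s i)) n ε) : stopTime (kern H) pick K C ω ≤ n :=
  stopTime_le hn (hC.trans (le_testStat_of_notMem_deviation hk hK hm p hpick hs hε hω))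

include hk hK hm hpick hs in
/-- The algorithm stops at the first `n ≥ n₀` without a deviation, if not before. The bound is a
measurable function, so that measurability of the clustering is not needed to integrate it. -/
lemma stopTime_le_add_tsum_indicator {n₀ : ℕ} (hn₀ : 2 ≤ n₀) {C ε : ℝ}
    (hε : dI H p + 2 * ε ≤ dH H p) (hC : ∀ n : ℕ, n₀ ≤ n → C / √(n : ℝ) ≤ dH H p - ε)
    (ω : Fin M × ℕ → 𝓧) :
    (stopTime (kern H) pick K C ω : ℝ≥0∞) ≤ n₀ + ∑' t : ℕ,
      (deviation H (fun i => p (s i)) (n₀ + t) ε).indicator (fun _ => (1 : ℝ≥0∞)) ω := by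
  classical
  by_cases hex : ∃ t, ω ∉ deviation H (fun i => p (s i)) (n₀ + t) ε
  · have hcross : stopTime (kern H) pick K C ω ≤ (n₀ + Nat.find hex : ℕ) :=
      stopTime_le_of_notMem_deviation hk hK hm p hpick hs (by omega) hε (hC _ (by omega))
        (Nat.find_spec hex)
    have hsum : ((Nat.find hex : ℕ) : ℝ≥0∞) ≤ ∑' t : ℕ,
        (deviation H (fun i => p (s i)) (n₀ + t) ε).indicator (fun _ => (1 : ℝ≥0∞)) ω := by
      refine le_trans ?_ (ENNReal.sum_le_tsum (Finset.range (Nat.find hex)))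
      rw [Finset.sum_congr rfl fun t ht => Set.indicator_of_mem
        (not_not.1 (Nat.find_min hex (Finset.mem_range.1 ht))) _]
      simp
    calc (stopTime (kern H) pick K C ω : ℝ≥0∞) ≤ ((n₀ + Nat.find hex : ℕ) : ℝ≥0∞) := by
          exact_mod_cast hcross
      _ = n₀ + (Nat.find hex : ℕ) := by push_cast; rfl
      _ ≤ _ := by gcongr
  · push Not at hex
    simp_rw [fun t => Set.indicator_of_mem (hex t) (fun _ => (1 : ℝ≥0∞))]
    rw [ENNReal.tsum_const_eq_top_of_ne_zero one_ne_zero]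
    simp

include hk hmeas hK hm hpick hs in
lemma expStopTime_le (hG : 0 < G) {n₀ : ℕ} (hn₀ : 2 ≤ n₀) {C ε : ℝ} (hε0 : 0 < ε)
    (hε : dI H p + 2 * ε ≤ dH H p) (hC : ∀ n : ℕ, n₀ ≤ n → C / √(n : ℝ) ≤ dH H p - ε) :
    expStopTime (kern H) pick p C s
      ≤ ENNReal.ofReal (n₀ + 4 * (M : ℝ) ^ 2 / (1 - Real.exp (-(ε ^ 2 / (8 * G))))) := by
  have hβ : 0 < ε ^ 2 / (8 * G) := by positivity
  have hq : Real.exp (-(ε ^ 2 / (8 * G))) < 1 := by rw [Real.exp_lt_one_iff]; linarith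
  have hq' : 0 < 1 - Real.exp (-(ε ^ 2 / (8 * G))) := by linarith
  have hmd := fun n => measurableSet_deviation (H := H) (fun i => p (s i)) hmeas n ε
  calc expStopTime (kern H) pick p C s
      ≤ ∫⁻ ω, (n₀ + ∑' t : ℕ, (deviation H (fun i => p (s i)) (n₀ + t) ε).indicator
          (fun _ => (1 : ℝ≥0∞)) ω) ∂(sampleLaw fun i => p (s i)) :=
        lintegral_mono fun ω => stopTime_le_add_tsum_indicator hk hK hm p hpick hs hn₀ hε hC ω
    _ = n₀ + ∑' t : ℕ, (sampleLaw fun i => p (s i))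
          (deviation H (fun i => p (s i)) (n₀ + t) ε) := by
        rw [lintegral_add_left measurable_const, lintegral_const, measure_univ, mul_one,
          lintegral_tsum fun t => (measurable_const.indicator (hmd _)).aemeasurable]
        congr 2
        ext t
        rw [lintegral_indicator_const (hmd _), one_mul]
    _ ≤ n₀ + ∑' t : ℕ, ENNReal.ofReal
          (4 * (M : ℝ) ^ 2 * Real.exp (-(ε ^ 2 / (8 * G) * ((n₀ + t : ℕ) : ℝ)))) := by
        gcongr with t
        refine (measure_deviation_le _ hk hmeas hG (by omega) hε0.le).trans_eq ?_
        rw [mul_div_right_comm]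
    _ ≤ _ := by
        rw [tsum_ofReal_exp_neg_mul_add _ (by positivity) hβ, ← ENNReal.ofReal_natCast,
          ← ENNReal.ofReal_add (by positivity) (by positivity)]
        gcongr
        refine mul_le_of_le_one_right (by positivity) ?_
        rw [Real.exp_le_one_iff]
        simp only [Left.neg_nonpos_iff]
        positivity

include hk hmeas hK hm hpick hs in
/-- Almost surely the algorithm stops: not stopping at all requires a deviation at every large
`n`, and the probabilities of these tend to zero. -/
lemma measure_stopTime_eq_top (hG : 0 < G) (hd : dI H p < dH H p) (C : ℝ) :
    dataLaw p s {ω | stopTime (kern H) pick K C ω = ⊤} = 0 := by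
  set ε := (dH H p - dI H p) / 2 with hεdef
  have hε0 : 0 < ε := by rw [hεdef]; linarith
  have hdI := dI_nonneg (H := H) hk p
  have hpos : 0 < dH H p - ε := by rw [hεdef]; linarith
  have hβ : 0 < ε ^ 2 / (8 * G) := by positivity
  have hlim1 : Tendsto (fun n : ℕ => C / √(n : ℝ)) atTop (𝓝 0) :=
    tendsto_const_nhds.div_atTop (Real.tendsto_sqrt_atTop.comp tendsto_natCast_atTop_atTop)
  have hlim2 : Tendsto (fun n : ℕ => ENNReal.ofReal (4 * (M : ℝ) ^ 2 *
      Real.exp (-(ε ^ 2 * n / (8 * G))))) atTop (𝓝 0) := by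
    rw [← ENNReal.ofReal_zero, ← mul_zero (4 * (M : ℝ) ^ 2)]
    refine ENNReal.tendsto_ofReal (Tendsto.const_mul _ ?_)
    simp_rw [mul_div_right_comm]
    exact Real.tendsto_exp_neg_atTop_nhds_zero.comp
      (tendsto_natCast_atTop_atTop.const_mul_atTop hβ)
  refine le_antisymm (ge_of_tendsto hlim2 ?_) bot_le
  filter_upwards [hlim1.eventually_lt_const hpos, eventually_ge_atTop 2] with n hn hn2
  refine (measure_mono fun ω hω => ?_).trans
    (measure_deviation_le (fun i => p (s i)) hk hmeas hG (by omega) hε0.le)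
  by_contra hcon
  have := stopTime_le_of_notMem_deviation hk hK hm p hpick hs hn2
    (by rw [hεdef]; linarith) hn.le hcon
  rw [show stopTime (kern H) pick K C ω = ⊤ from hω] at this
  simp at this

include hk hmeas hK hm hpick hs in
/-- The error probability for a splitting time `n₁`: before `n₁`, stopping wrongly requires a
deviation of at least `C / √n - d_I ≥ δ C / √n`; from `n₁` on, a wrong clustering requires a
deviation of at least `ε`. -/
lemma measure_errorEvent_le (hG : 0 < G) {n₁ : ℕ} (hn₁ : 1 ≤ n₁) {C δ ε : ℝ} (hC : 0 ≤ C)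
    (hδ : 0 ≤ δ) (hε0 : 0 < ε) (hε : dI H p + 2 * ε ≤ dH H p)
    (hsmall : ∀ n : ℕ, n < n₁ → dI H p * √(n : ℝ) ≤ (1 - δ) * C) :
    dataLaw p s (errorEvent (kern H) pick C fun i => (s i).1)
      ≤ ENNReal.ofReal (4 * (M : ℝ) ^ 2 * (n₁ * Real.exp (-(δ ^ 2 * C ^ 2 / (8 * G)))
        + 1 / (1 - Real.exp (-(ε ^ 2 / (8 * G)))) * Real.exp (-(ε ^ 2 / (8 * G) * n₁)))) := by
  have hβ : 0 < ε ^ 2 / (8 * G) := by positivity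
  have hq : Real.exp (-(ε ^ 2 / (8 * G))) < 1 := by rw [Real.exp_lt_one_iff]; linarith
  have hq' : 0 < 1 - Real.exp (-(ε ^ 2 / (8 * G))) := by linarith
  set P := sampleLaw fun i => p (s i) with hP
  have hsub : errorEvent (kern H) pick C (fun i => (s i).1)
      ⊆ {ω | stopTime (kern H) pick K C ω = ⊤}
        ∪ ((⋃ n ∈ Finset.Ico 2 n₁, deviation H (fun i => p (s i)) n (δ * C / √(n : ℝ)))
          ∪ ⋃ t : ℕ, deviation H (fun i => p (s i)) (n₁ + t) ε) := by
    intro ω hω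
    by_cases htop : stopTime (kern H) pick K C ω = ⊤
    · exact Or.inl htop
    obtain ⟨n, hn⟩ := ENat.ne_top_iff_exists.1 htop
    obtain ⟨hn2, hcross⟩ := of_stopTime_eq hn.symm
    have hwrong := hω n hn.symm
    refine Or.inr ?_
    rcases lt_or_ge n n₁ with hlt | hge
    · refine Or.inl (Set.mem_iUnion₂.2 ⟨n, Finset.mem_Ico.2 ⟨hn2, hlt⟩, ?_⟩)
      obtain ⟨i, j, hij⟩ := mem_deviation_of_clustersAt_ne hk hK hm p hpick hs hwrong hcross
      have hsq : 0 < √(n : ℝ) := Real.sqrt_pos.2 (by positivity)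
      refine ⟨i, j, le_trans ?_ hij⟩
      rw [div_sub' hsq.ne']
      gcongr
      linarith [hsmall n hlt]
    · refine Or.inr (Set.mem_iUnion.2 ⟨n - n₁, ?_⟩)
      rw [Nat.add_sub_cancel' hge]
      by_contra hcon
      exact hwrong (clustersAt_eq_of_notMem_deviation hk hK hm p hpick hs hε hcon)
  have hfirst : P (⋃ n ∈ Finset.Ico 2 n₁, deviation H (fun i => p (s i)) n (δ * C / √(n : ℝ)))
      ≤ ENNReal.ofReal (4 * (M : ℝ) ^ 2 * (n₁ * Real.exp (-(δ ^ 2 * C ^ 2 / (8 * G))))) := by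
    refine (measure_biUnion_finset_le _ _).trans ?_
    calc ∑ n ∈ Finset.Ico 2 n₁, P (deviation H (fun i => p (s i)) n (δ * C / √(n : ℝ)))
        ≤ ∑ _n ∈ Finset.Ico 2 n₁, ENNReal.ofReal
            (4 * (M : ℝ) ^ 2 * Real.exp (-(δ ^ 2 * C ^ 2 / (8 * G)))) := by
          refine Finset.sum_le_sum fun n hn => ?_
          have hn2 : 2 ≤ n := (Finset.mem_Ico.1 hn).1
          have hn0 : (0 : ℝ) < n := by positivity
          refine (measure_deviation_le _ hk hmeas hG (by omega) (by positivity)).trans_eq ?_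
          rw [div_pow, Real.sq_sqrt hn0.le, div_mul_cancel₀ _ hn0.ne', mul_pow]
      _ ≤ n₁ * ENNReal.ofReal (4 * (M : ℝ) ^ 2 * Real.exp (-(δ ^ 2 * C ^ 2 / (8 * G)))) := by
          rw [Finset.sum_const, Nat.card_Ico, nsmul_eq_mul]
          gcongr
          exact Nat.sub_le _ _
      _ = _ := by
          rw [← ENNReal.ofReal_natCast, ← ENNReal.ofReal_mul (by positivity)]
          congr 1; ring
  have hsecond : P (⋃ t : ℕ, deviation H (fun i => p (s i)) (n₁ + t) ε)
      ≤ ENNReal.ofReal (4 * (M : ℝ) ^ 2 * (1 / (1 - Real.exp (-(ε ^ 2 / (8 * G))))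
        * Real.exp (-(ε ^ 2 / (8 * G) * n₁)))) := by
    refine (measure_iUnion_le _).trans ?_
    calc ∑' t : ℕ, P (deviation H (fun i => p (s i)) (n₁ + t) ε)
        ≤ ∑' t : ℕ, ENNReal.ofReal
          (4 * (M : ℝ) ^ 2 * Real.exp (-(ε ^ 2 / (8 * G) * ((n₁ + t : ℕ) : ℝ)))) := by
          gcongr with t
          refine (measure_deviation_le _ hk hmeas hG (by omega) hε0.le).trans_eq ?_
          rw [mul_div_right_comm]
      _ = _ := by
          rw [tsum_ofReal_exp_neg_mul_add _ (by positivity) hβ]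
          congr 1; ring
  calc dataLaw p s (errorEvent (kern H) pick C fun i => (s i).1)
      ≤ 0 + (ENNReal.ofReal (4 * (M : ℝ) ^ 2 * (n₁ * Real.exp (-(δ ^ 2 * C ^ 2 / (8 * G)))))
        + ENNReal.ofReal (4 * (M : ℝ) ^ 2 * (1 / (1 - Real.exp (-(ε ^ 2 / (8 * G))))
        * Real.exp (-(ε ^ 2 / (8 * G) * n₁))))) := by
        refine (measure_mono hsub).trans ((measure_union_le _ _).trans (add_le_add ?_
          ((measure_union_le _ _).trans (add_le_add hfirst hsecond))))
        exact (measure_stopTime_eq_top hk hmeas hK hm p hpick hs hG (by linarith) C).le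
    _ = _ := by
        rw [zero_add, ← ENNReal.ofReal_add (by positivity) (by positivity)]
        congr 1; ring

end Algorithm

/-! ### Asymptotics as the threshold grows -/

section Asymptotics

/-- Polynomial factors are absorbed by halving the exponential rate. -/
lemma eventually_mul_exp_neg_two_mul_le {a : ℝ} (ha : 0 < a) (A B : ℝ) :
    ∀ᶠ C : ℝ in atTop,
      (A * C ^ 2 + B) * Real.exp (-(2 * (a * C ^ 2))) ≤ Real.exp (-(a * C ^ 2)) := by
  have hy : Tendsto (fun C : ℝ => a * C ^ 2) atTop atTop :=
    (tendsto_pow_atTop two_ne_zero).const_mul_atTop ha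
  have h1 := ((Real.tendsto_pow_mul_exp_neg_atTop_nhds_zero 1).comp hy).const_mul (A / a)
  have h0 := (Real.tendsto_exp_neg_atTop_nhds_zero.comp hy).const_mul B
  have h := h1.add h0
  simp only [mul_zero, add_zero] at h
  filter_upwards [h.eventually_le_const one_pos] with C hC
  simp only [Function.comp, pow_one] at hC
  have he : Real.exp (-(2 * (a * C ^ 2))) = Real.exp (-(a * C ^ 2)) * Real.exp (-(a * C ^ 2)) := by
    rw [← Real.exp_add]; congr 1; ring
  calc (A * C ^ 2 + B) * Real.exp (-(2 * (a * C ^ 2)))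
      = (A / a * (a * C ^ 2 * Real.exp (-(a * C ^ 2))) + B * Real.exp (-(a * C ^ 2)))
          * Real.exp (-(a * C ^ 2)) := by rw [he]; field_simp
    _ ≤ 1 * Real.exp (-(a * C ^ 2)) := by gcongr
    _ = _ := one_mul _

variable {𝓧 : Type*} [MeasurableSpace 𝓧] {H : Type*} [NormedAddCommGroup H]
  [InnerProductSpace ℝ H] [CompleteSpace H] [RKHS ℝ H 𝓧 ℝ]
  {G : ℝ} (hk : ∀ x y : 𝓧, 0 ≤ kern H x y ∧ kern H x y ≤ G)
  (hmeas : Measurable fun z : 𝓧 × 𝓧 => kern H z.1 z.2) {M K : ℕ} (hK : 2 ≤ K) {m : Fin K → ℕ}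
  (hm : ∀ k, 1 ≤ m k) (p : (Σ k : Fin K, Fin (m k)) → Measure 𝓧) [∀ a, IsProbabilityMeasure (p a)]
  {pick : Finset (Finset (Fin M) × Finset (Fin M)) → Finset (Fin M) × Finset (Fin M)}
  (hpick : ∀ t, t.Nonempty → pick t ∈ t)

include hk hmeas hK hm hpick in
/-- The maximum error probability decays at least at the rate `a C²`. The two phases of the
algorithm are separated at `n₁ ≈ C² / ((1 - δ)² d_H²)`, and the concentration inequality yields
twice the required exponent in both. -/
lemma eventually_pMax_le (hG : 0 < G) {δ ε a : ℝ} (hδ0 : 0 < δ) (hδ1 : δ < 1)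
    (hδ : dI H p ≤ (1 - δ) ^ 2 * dH H p) (hdH : 0 < dH H p) (hε0 : 0 < ε)
    (hε : dI H p + 2 * ε ≤ dH H p) (ha : 0 < a) (ha₁ : a ≤ δ ^ 2 / (16 * G))
    (ha₂ : a ≤ ε ^ 2 / (16 * G) / ((1 - δ) ^ 2 * dH H p ^ 2)) :
    ∀ᶠ C : ℝ in atTop, pMax (kern H) pick p C ≤ ENNReal.ofReal (Real.exp (-(a * C ^ 2))) := by
  set κ := (1 - δ) ^ 2 * dH H p ^ 2 with hκdef
  have hδ' : 0 < 1 - δ := by linarith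
  have hκ : 0 < κ := by positivity
  set β := ε ^ 2 / (8 * G) with hβdef
  have hβ : 0 < β := by positivity
  have hq : Real.exp (-β) < 1 := by rw [Real.exp_lt_one_iff]; linarith
  have hq' : 0 < 1 - Real.exp (-β) := by linarith
  set B := 1 / (1 - Real.exp (-β)) with hB
  have hBpos : 0 < B := by positivity
  filter_upwards [eventually_mul_exp_neg_two_mul_le ha (4 * (M : ℝ) ^ 2 / κ)
    (4 * (M : ℝ) ^ 2 * (1 + B)), eventually_gt_atTop 0] with C hCexp hC
  refine iSup₂_le fun s hs => ?_
  set n₁ := ⌈C ^ 2 / κ⌉₊ with hn₁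
  have hx : 0 < C ^ 2 / κ := by positivity
  have hn₁pos : 1 ≤ n₁ := Nat.ceil_pos.2 hx
  have hn₁le : C ^ 2 / κ ≤ n₁ := Nat.le_ceil _
  have hn₁lt : (n₁ : ℝ) < C ^ 2 / κ + 1 := Nat.ceil_lt_add_one hx.le
  have hsmall : ∀ n : ℕ, n < n₁ → dI H p * √(n : ℝ) ≤ (1 - δ) * C := by
    intro n hn
    have hn' : (n : ℝ) < C ^ 2 / κ := Nat.lt_ceil.1 hn
    have hsqrt : √(n : ℝ) ≤ C / ((1 - δ) * dH H p) := by
      refine Real.sqrt_le_iff.2 ⟨by positivity, ?_⟩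
      rw [div_pow, mul_pow, ← hκdef]
      exact hn'.le
    calc dI H p * √(n : ℝ) ≤ (1 - δ) ^ 2 * dH H p * (C / ((1 - δ) * dH H p)) := by gcongr
      _ = (1 - δ) * C := by field_simp
  refine (measure_errorEvent_le hk hmeas hK hm p hpick hs hG hn₁pos hC.le hδ0.le hε0 hε
    hsmall).trans (ENNReal.ofReal_le_ofReal (le_trans ?_ hCexp))
  have he₁ : 2 * (a * C ^ 2) ≤ δ ^ 2 * C ^ 2 / (8 * G) := by
    calc 2 * (a * C ^ 2) ≤ 2 * (δ ^ 2 / (16 * G) * C ^ 2) := by gcongr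
      _ = _ := by field_simp; ring
  have he₂ : 2 * (a * C ^ 2) ≤ β * n₁ := by
    calc 2 * (a * C ^ 2) ≤ 2 * (ε ^ 2 / (16 * G) / κ * C ^ 2) := by gcongr
      _ = β * (C ^ 2 / κ) := by rw [hβdef]; field_simp; ring
      _ ≤ _ := by gcongr
  calc 4 * (M : ℝ) ^ 2 * (n₁ * Real.exp (-(δ ^ 2 * C ^ 2 / (8 * G))) + B * Real.exp (-(β * n₁)))
      ≤ 4 * (M : ℝ) ^ 2 * ((C ^ 2 / κ + 1) * Real.exp (-(2 * (a * C ^ 2)))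
          + B * Real.exp (-(2 * (a * C ^ 2)))) := by gcongr
    _ = _ := by ring

include hk hmeas hK hm hpick in
/-- For every `ε`, the algorithm typically stops as soon as `C / √n ≤ d_H - ε`, so that
`E[N] ≤ C² / (d_H - ε)² + O(1)`; then `ε` tends to zero. -/
lemma eventually_expStopTime_le (hG : 0 < G) (hd : dI H p < dH H p)
    {s : Fin M → Σ k : Fin K, Fin (m k)} (hs : Function.Surjective s) {η : ℝ} (hη : 0 < η) :
    ∀ᶠ C : ℝ in atTop, expStopTime (kern H) pick p C s
      ≤ ENNReal.ofReal (C ^ 2 / dH H p ^ 2 * (1 + η)) := by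
  have hdH : 0 < dH H p := (dI_nonneg (H := H) hk p).trans_lt hd
  obtain ⟨ε, ⟨hε0, hε1⟩, hε2, hε3⟩ : ∃ ε : ℝ, (0 < ε ∧ dI H p + 2 * ε < dH H p) ∧
      dH H p ^ 2 / (dH H p - ε) ^ 2 < 1 + η ∧ ε < dH H p := by
    have hlim1 : Tendsto (fun ε : ℝ => dH H p ^ 2 / (dH H p - ε) ^ 2) (𝓝[>] 0) (𝓝 1) := by
      have : ContinuousAt (fun ε : ℝ => dH H p ^ 2 / (dH H p - ε) ^ 2) 0 :=
        ContinuousAt.div (by fun_prop) (by fun_prop) (by simpa using hdH.ne')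
      have h := this.tendsto
      simp only [sub_zero, div_self (pow_ne_zero 2 hdH.ne')] at h
      exact h.mono_left nhdsWithin_le_nhds
    have hlim2 : Tendsto (fun ε : ℝ => ε) (𝓝[>] 0) (𝓝 0) := nhdsWithin_le_nhds
    have h := (((hlim1.eventually_lt_const (by linarith : 1 < 1 + η)).and
      (hlim2.eventually_lt_const (by linarith : 0 < (dH H p - dI H p) / 2))).and
      (hlim2.eventually_lt_const hdH)).and self_mem_nhdsWithin
    obtain ⟨ε, ⟨⟨h1, h2⟩, h3⟩, h4⟩ := h.exists
    exact ⟨ε, ⟨h4, by linarith⟩, h1, h3⟩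
  have hpos : 0 < dH H p - ε := by linarith
  set B := 4 * (M : ℝ) ^ 2 / (1 - Real.exp (-(ε ^ 2 / (8 * G)))) with hB
  set γ := (1 + η) / dH H p ^ 2 - 1 / (dH H p - ε) ^ 2 with hγ
  have hγpos : 0 < γ := by
    rw [hγ, sub_pos, div_lt_div_iff₀ (by positivity) (by positivity), one_mul]
    rwa [div_lt_iff₀ (by positivity)] at hε2
  have hbig : Tendsto (fun C : ℝ => γ * C ^ 2) atTop atTop :=
    (tendsto_pow_atTop two_ne_zero).const_mul_atTop hγpos
  filter_upwards [hbig.eventually_ge_atTop (3 + B), eventually_gt_atTop 0] with C hCB hC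
  set n₀ := ⌈C ^ 2 / (dH H p - ε) ^ 2⌉₊ + 2 with hn₀
  have hx : 0 < C ^ 2 / (dH H p - ε) ^ 2 := by positivity
  have hn₀lt : (n₀ : ℝ) < C ^ 2 / (dH H p - ε) ^ 2 + 3 := by
    rw [hn₀]; push_cast; linarith [Nat.ceil_lt_add_one hx.le]
  have hcross : ∀ n : ℕ, n₀ ≤ n → C / √(n : ℝ) ≤ dH H p - ε := by
    intro n hn
    have h1 : C ^ 2 / (dH H p - ε) ^ 2 ≤ n := (Nat.le_ceil _).trans (by
      have : ⌈C ^ 2 / (dH H p - ε) ^ 2⌉₊ ≤ n := by omega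
      exact_mod_cast this)
    have hn0 : (0 : ℝ) < n := hx.trans_le h1
    rw [div_le_iff₀ (Real.sqrt_pos.2 hn0), mul_comm, ← div_le_iff₀ hpos]
    exact Real.le_sqrt_of_sq_le (by rwa [div_pow])
  refine (expStopTime_le hk hmeas hK hm p hpick hs hG (by omega) hε0 hε1.le hcross).trans
    (ENNReal.ofReal_le_ofReal ?_)
  calc (n₀ : ℝ) + B ≤ C ^ 2 / (dH H p - ε) ^ 2 + (3 + B) := by linarith
    _ ≤ C ^ 2 / (dH H p - ε) ^ 2 + γ * C ^ 2 := by gcongr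
    _ = C ^ 2 / dH H p ^ 2 * (1 + η) := by rw [hγ]; ring

include hk hmeas hK hm hpick in
/-- The error term `r` is the relative excess of `E[N]` over `C² / d_H²`. -/
lemma exists_expStopTime_le (hG : 0 < G) (hd : dI H p < dH H p)
    {s : Fin M → Σ k : Fin K, Fin (m k)} (hs : Function.Surjective s) :
    ∃ r : ℝ → ℝ, (∀ C, 0 ≤ r C) ∧ Tendsto r atTop (𝓝 0) ∧ ∀ᶠ C : ℝ in atTop,
      expStopTime (kern H) pick p C s ≤ ENNReal.ofReal (C ^ 2 / dH H p ^ 2 * (1 + r C)) := by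
  have hdH : 0 < dH H p := (dI_nonneg (H := H) hk p).trans_lt hd
  set r : ℝ → ℝ := fun C =>
    max 0 ((expStopTime (kern H) pick p C s).toReal / (C ^ 2 / dH H p ^ 2) - 1) with hr
  refine ⟨r, fun C => le_max_left _ _, ?_, ?_⟩
  · refine tendsto_order.2 ⟨fun a ha => Eventually.of_forall fun C => ha.trans_le (le_max_left _ _),
      fun η hη => ?_⟩
    filter_upwards [eventually_expStopTime_le hk hmeas hK hm p hpick hG hd hs (half_pos hη),
      eventually_gt_atTop 0] with C hC hC0
    refine max_lt hη ?_
    have h1 := ENNReal.toReal_le_of_le_ofReal (by positivity) hC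
    have h2 : (expStopTime (kern H) pick p C s).toReal / (C ^ 2 / dH H p ^ 2) ≤ 1 + η / 2 := by
      rw [div_le_iff₀ (by positivity)]; linarith
    linarith
  · filter_upwards [eventually_expStopTime_le hk hmeas hK hm p hpick hG hd hs one_pos,
      eventually_gt_atTop 0] with C hC hC0
    have hfin : expStopTime (kern H) pick p C s ≠ ⊤ := ne_top_of_le_ne_top ENNReal.ofReal_ne_top hC
    rw [← ENNReal.ofReal_toReal hfin]
    refine ENNReal.ofReal_le_ofReal ?_
    have h0 : 0 < C ^ 2 / dH H p ^ 2 := by positivity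
    have h1 : (expStopTime (kern H) pick p C s).toReal / (C ^ 2 / dH H p ^ 2) ≤ 1 + r C := by
      have : (expStopTime (kern H) pick p C s).toReal / (C ^ 2 / dH H p ^ 2) - 1 ≤ r C :=
        le_max_right _ _
      linarith
    rw [div_le_iff₀ h0] at h1
    linarith

end Asymptotics

end SlinkSeq

theorem theorem5 {𝓧 : Type*} [MeasurableSpace 𝓧]
    {H : Type*} [NormedAddCommGroup H] [InnerProductSpace ℝ H] [CompleteSpace H] [RKHS ℝ H 𝓧 ℝ]
    (hmeas : Measurable fun z : 𝓧 × 𝓧 => SlinkSeq.kern H z.1 z.2)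
    (G : ℝ) (hk : ∀ x y : 𝓧, 0 ≤ SlinkSeq.kern H x y ∧ SlinkSeq.kern H x y ≤ G)
    {M K : ℕ} (hK : 2 ≤ K) {m : Fin K → ℕ} (hm : ∀ k, 1 ≤ m k)
    (p : (Σ k : Fin K, Fin (m k)) → Measure 𝓧) [∀ a, IsProbabilityMeasure (p a)]
    (pick : Finset (Finset (Fin M) × Finset (Fin M)) → Finset (Fin M) × Finset (Fin M))
    (hpick : ∀ t, t.Nonempty → pick t ∈ t)
    (hd : SlinkSeq.dI H p < SlinkSeq.dH H p)
    (δ : ℝ) (hδ0 : 0 < δ) (hδ1 : δ < 1 - √(SlinkSeq.dI H p / SlinkSeq.dH H p))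
    (dth : ℝ) (hdth0 : SlinkSeq.dI H p < dth) (hdth1 : dth < SlinkSeq.dH H p)
    (bf : ℝ) (hbf : bf = min ((dth - SlinkSeq.dI H p) ^ 2 / (16 * G))
      ((SlinkSeq.dH H p - dth) ^ 2 / (16 * G)))
    (α₁ : ℝ) (hα₁ : α₁ = min (δ ^ 2 / (16 * G)) (bf / ((1 - δ) ^ 2 * SlinkSeq.dH H p ^ 2)))
    (α : ℝ) (hα : α = α₁ * SlinkSeq.dH H p ^ 2) :
    0 < α ∧
    ∀ s : Fin M → Σ k : Fin K, Fin (m k), Function.Surjective s →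
      ∃ r : ℝ → ℝ, Tendsto r atTop (𝓝 0) ∧ ∀ᶠ C : ℝ in atTop,
        (SlinkSeq.expStopTime (SlinkSeq.kern H) pick p C s : EReal) ≤
          -ENNReal.log (SlinkSeq.pMax (SlinkSeq.kern H) pick p C) / (α : EReal) *
            ((1 + r C : ℝ) : EReal) := by
  have hdI : 0 ≤ SlinkSeq.dI H p := SlinkSeq.dI_nonneg hk p
  have hdH : 0 < SlinkSeq.dH H p := hdI.trans_lt hd
  have hG : 0 < G := by
    by_contra hG
    have h := SlinkSeq.dH_le_two_mul_sqrt (H := H) hk hK hm p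
    rw [Real.sqrt_eq_zero_of_nonpos (not_lt.1 hG)] at h
    linarith
  have hδ1' : δ < 1 := by linarith [Real.sqrt_nonneg (SlinkSeq.dI H p / SlinkSeq.dH H p)]
  have hδ' : 0 < 1 - δ := by linarith
  have hδd : SlinkSeq.dI H p ≤ (1 - δ) ^ 2 * SlinkSeq.dH H p := by
    rw [← div_le_iff₀ hdH]
    exact (Real.sqrt_le_left hδ'.le).1 (by linarith)
  set ε := min (dth - SlinkSeq.dI H p) (SlinkSeq.dH H p - dth) with hεdef
  have hε0 : 0 < ε := lt_min (by linarith) (by linarith)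
  have hε : SlinkSeq.dI H p + 2 * ε ≤ SlinkSeq.dH H p := by
    linarith [min_le_left (dth - SlinkSeq.dI H p) (SlinkSeq.dH H p - dth),
      min_le_right (dth - SlinkSeq.dI H p) (SlinkSeq.dH H p - dth)]
  have hbfε : bf = ε ^ 2 / (16 * G) := by
    rw [hbf, hεdef]
    rcases le_total (dth - SlinkSeq.dI H p) (SlinkSeq.dH H p - dth) with h | h
    · rw [min_eq_left h, min_eq_left (by gcongr)]
    · rw [min_eq_right h, min_eq_right (by gcongr)]
  have hbf0 : 0 < bf := by rw [hbfε]; positivity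
  have hα₁0 : 0 < α₁ := by rw [hα₁]; exact lt_min (by positivity) (by positivity)
  have hα0 : 0 < α := by rw [hα]; positivity
  refine ⟨hα0, fun s hs => ?_⟩
  obtain ⟨r, hr0, hr, hE⟩ := SlinkSeq.exists_expStopTime_le hk hmeas hK hm p hpick hG hd hs
  refine ⟨r, hr, ?_⟩
  filter_upwards [hE, SlinkSeq.eventually_pMax_le hk hmeas hK hm p hpick hG hδ0 hδ1' hδd hdH hε0 hε
    hα₁0 (hα₁ ▸ min_le_left _ _) (hbfε ▸ hα₁ ▸ min_le_right _ _)] with C hEC hPC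
  have h1 : 0 ≤ 1 + r C := by linarith [hr0 C]
  have hlog : ((α₁ * C ^ 2 : ℝ) : EReal)
      ≤ -ENNReal.log (SlinkSeq.pMax (SlinkSeq.kern H) pick p C) := by
    have h := ENNReal.log_monotone hPC
    rw [ENNReal.log_ofReal_of_pos (Real.exp_pos _), Real.log_exp] at h
    rw [EReal.le_neg]
    exact_mod_cast h
  calc (SlinkSeq.expStopTime (SlinkSeq.kern H) pick p C s : EReal)
      ≤ ((C ^ 2 / SlinkSeq.dH H p ^ 2 * (1 + r C) : ℝ) : EReal) := by
        have h := EReal.coe_ennreal_le_coe_ennreal_iff.2 hEC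
        rwa [EReal.coe_ennreal_ofReal, max_eq_left (by positivity)] at h
    _ = ((α₁ * C ^ 2 : ℝ) : EReal) / (α : EReal) * ((1 + r C : ℝ) : EReal) := by
        rw [← EReal.coe_div, ← EReal.coe_mul, hα]
        congr 2
        field_simp
    _ ≤ _ := by
        refine mul_le_mul_of_nonneg_right (EReal.div_le_div_right_of_nonneg ?_ hlog) ?_
        · exact_mod_cast hα0.le
        · exact_mod_cast h1
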